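/- Consider tropical (min-plus) linear systems over $\mathbb{Z}$. A vector $x\in\mathbb{Z}^n$ solves the tropical linear equation with coefficient vector $a\in\mathbb{Z}^n$ if the minimum $\min_{1\le j\le n}(a_j+x_j)$ is attained for at least two different indices $j$; it solves the tropical linear system with matrix $A\in\mathbb{Z}^{m\times n}$ if it solves the equation given by each row of $A$. Let TropSolv be the problem: given $A\in\mathbb{Z}^{m\times n}$, decide whether the tropical linear system of $A$ has a solution in $\mathbb{Z}^n$. Let TropImpl be the problem: given $A\in\mathbb{Z}^{m\times n}$ and $l\in\mathbb{Z}^n$, decide whether every solution $x\in\mathbb{Z}^n$ of the tropical linear system of $A$ solves the tropical linear equation with coefficient vector $l$. Integers are written in binary. Theorem. TropImpl $\le_T$ TropSolv, that is, TropImpl is polynomial-time Turing reducible to TropSolv: there is a deterministic oracle Turing machine which, with an oracle for TropSolv, decides TropImpl in time polynomial in the length of the encoded input. Moreover, the machine can be chosen so that on every instance $(A,l)$ with $n$ variables it makes $O(n^2)$ oracle queries (at most $C(n^2+1)$ for an absolute constant $C$). -/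

import Mathlib

namespace Trop

/-! ### Tropical linear systems over the integers -/

/-- `x` solves the tropical linear equation with coefficient vector `a`: the minimum of
`a j + x j` over all columns `j` is attained in at least two different columns. -/
def SolvesRow {n : ℕ} (a x : Fin n → ℤ) : Prop :=
  ∃ k l : Fin n, k < l ∧ a k + x k = a l + x l ∧ ∀ j : Fin n, a k + x k ≤ a j + x j

/-- `x` solves the tropical linear system with matrix `A`. -/
def Solves {m n : ℕ} (A : Matrix (Fin m) (Fin n) ℤ) (x : Fin n → ℤ) : Prop :=
  ∀ i : Fin m, SolvesRow (A i) x

/-- The tropical linear system with matrix `A` has a solution. -/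
def Solvable {m n : ℕ} (A : Matrix (Fin m) (Fin n) ℤ) : Prop :=
  ∃ x : Fin n → ℤ, Solves A x

/-- Every solution of the tropical linear system `A` solves the tropical equation `l`. -/
def Implies {m n : ℕ} (A : Matrix (Fin m) (Fin n) ℤ) (l : Fin n → ℤ) : Prop :=
  ∀ x : Fin n → ℤ, Solves A x → SolvesRow l x

/-! ### Words and decision problems -/

/-- The alphabet: the two binary digits, a minus sign, a mark ending a number and a mark
ending a line. -/
inductive Sym : Type
  | zero
  | one
  | minus
  | sep
  | eol
  deriving DecidableEq

/-- A decision problem: instances, their encoding as words, and the yes-instances. -/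
structure DecisionProblem where
  Inst : Type
  encode : Inst → List Sym
  yes : Inst → Prop

/-- The set of encodings of yes-instances. -/
def DecisionProblem.language (P : DecisionProblem) : Set (List Sym) :=
  {w | ∃ x : P.Inst, P.encode x = w ∧ P.yes x}

/-- Signed binary notation, least significant digit first, closed by `sep`
(zero has no digits). -/
def encodeInt (z : ℤ) : List Sym :=
  (if z < 0 then [Sym.minus] else []) ++
    z.natAbs.bits.map (fun b => if b then Sym.one else Sym.zero) ++ [Sym.sep]

/-- The entries of a row one after the other, closed by `eol`. -/
def encodeRow {n : ℕ} (a : Fin n → ℤ) : List Sym :=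
  (List.ofFn fun j => encodeInt (a j)).flatten ++ [Sym.eol]

/-- A header line of `n` marks giving the number of columns, then the rows. -/
def encodeMatrix {m n : ℕ} (A : Matrix (Fin m) (Fin n) ℤ) : List Sym :=
  List.replicate n Sym.sep ++ [Sym.eol] ++ (List.ofFn fun i => encodeRow (A i)).flatten

/-- An integer matrix with `m` rows and `n` columns. -/
structure SolvInst where
  m : ℕ
  n : ℕ
  A : Matrix (Fin m) (Fin n) ℤ

/-- An integer matrix with `m` rows and `n` columns, and an integer vector of length `n`. -/
structure ImplInst where
  m : ℕ
  n : ℕ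
  A : Matrix (Fin m) (Fin n) ℤ
  l : Fin n → ℤ

/-- Given an integer matrix, decide whether its tropical linear system is solvable. -/
def tropSolv : DecisionProblem where
  Inst := SolvInst
  encode x := encodeMatrix x.A
  yes x := Solvable x.A

/-- Given an integer matrix and an integer vector, decide whether the tropical linear system
of the matrix implies the tropical linear equation of the vector. -/
def tropImpl : DecisionProblem where
  Inst := ImplInst
  encode x := encodeMatrix x.A ++ encodeRow x.l
  yes x := Implies x.A x.l

/-! ### Oracle Turing machines -/

/-- The instruction attached to a state of an oracle machine with stacks `K` and states `Q`:
push a symbol; pop a stack and branch on the symbol (`none` if the stack is empty); ask the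
oracle about the word on the query stack and branch on its answer; halt with an answer. -/
inductive Instr (K Q : Type) : Type
  | push (k : K) (a : Sym) (next : Q)
  | pop (k : K) (next : Option Sym → Q)
  | query (ifYes ifNo : Q)
  | halt (answer : Bool)

/-- A deterministic multi-tape oracle Turing machine, in multi-stack form (a tape is a pair of
stacks, the two parts of the tape on either side of the head): a finite control, finitely many
stacks over a finite alphabet, and a distinguished input stack and query stack. -/
structure OracleMachine where
  K : Type
  [finK : Fintype K]
  [decK : DecidableEq K]
  Q : Type
  [finQ : Fintype Q]
  inputStack : K
  queryStack : K
  start : Q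
  prog : Q → Instr K Q

attribute [instance] OracleMachine.finK OracleMachine.decK OracleMachine.finQ

namespace OracleMachine

variable (M : OracleMachine)

/-- A configuration: the current state and the contents of the stacks, top first. -/
@[ext]
structure Cfg where
  state : M.Q
  stk : M.K → List Sym

/-- At the start the input word is on the input stack and all other stacks are empty. -/
def init (w : List Sym) : M.Cfg where
  state := M.start
  stk := Function.update (fun _ => []) M.inputStack w

open Classical in
/-- One step of the computation with oracle `O`, touching at most the top symbol of one stack.
A query is answered in one step, and the query stack is erased. Halting states are absorbing. -/
noncomputable def step (O : Set (List Sym)) (c : M.Cfg) : M.Cfg :=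
  match M.prog c.state with
  | .push k a next => ⟨next, Function.update c.stk k (a :: c.stk k)⟩
  | .pop k next => ⟨next (c.stk k).head?, Function.update c.stk k (c.stk k).tail⟩
  | .query ifYes ifNo =>
      ⟨if c.stk M.queryStack ∈ O then ifYes else ifNo, Function.update c.stk M.queryStack []⟩
  | .halt _ => c

/-- The configuration after `t` steps on input `w` with oracle `O`. -/
noncomputable def run (O : Set (List Sym)) (w : List Sym) (t : ℕ) : M.Cfg :=
  (M.step O)^[t] (M.init w)

/-- On input `w` with oracle `O` the machine halts after at most `T` steps with answer `b`. -/
def HaltsWithin (O : Set (List Sym)) (w : List Sym) (T : ℕ) (b : Bool) : Prop :=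
  ∃ t ≤ T, M.prog (M.run O w t).state = .halt b

open Classical in
/-- The number of oracle queries made in the first `t` steps on input `w` with oracle `O`. -/
noncomputable def queryCount (O : Set (List Sym)) (w : List Sym) (t : ℕ) : ℕ :=
  ((Finset.range t).filter
    (fun s => ∃ q₁ q₂ : M.Q, M.prog (M.run O w s).state = .query q₁ q₂)).card

/-- With an oracle for `R`, the machine decides `P` in time polynomial in the length of the
encoded instance; that is, it is a polynomial-time Turing reduction of `P` to `R`. -/
def IsPolyTimeTuringReduction (P R : DecisionProblem) : Prop :=
  ∃ p : Polynomial ℕ, ∀ x : P.Inst, ∃ b : Bool,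
    M.HaltsWithin R.language (P.encode x) (p.eval (P.encode x).length) b ∧
      (b = true ↔ P.yes x)

end OracleMachine

end Trop

namespace Trop

/-! ### The reduction -/

theorem solvesRow_of_ne {n : ℕ} {a x : Fin n → ℤ} {p q : Fin n} (hpq : p ≠ q)
    (h : a p + x p = a q + x q) (hmin : ∀ j, a p + x p ≤ a j + x j) : SolvesRow a x := by
  rcases lt_or_gt_of_ne hpq with hlt | hlt
  · exact ⟨p, q, hlt, h, hmin⟩
  · exact ⟨q, p, hlt, h.symm, fun j => h ▸ hmin j⟩

theorem not_solvesRow_of_lt {n : ℕ} {a x : Fin n → ℤ} (p : Fin n)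
    (h : ∀ j, j ≠ p → a p + x p < a j + x j) : ¬ SolvesRow a x := by
  rintro ⟨q, r, hqr, he, hmin⟩
  by_cases hq : q = p
  · subst hq
    have := h r hqr.ne'
    omega
  · have := h q hq
    have := hmin p
    omega

theorem not_solvesRow_iff {n : ℕ} [NeZero n] {a x : Fin n → ℤ} :
    ¬ SolvesRow a x ↔ ∃ p, ∀ j, j ≠ p → a p + x p < a j + x j := by
  refine ⟨fun h => ?_, fun ⟨p, hp⟩ => not_solvesRow_of_lt p hp⟩
  obtain ⟨p, -, hp⟩ := Finset.exists_min_image Finset.univ (fun j => a j + x j)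
    ⟨0, Finset.mem_univ _⟩
  refine ⟨p, fun j hj => ?_⟩
  by_contra hlt
  have h1 := hp j (Finset.mem_univ _)
  exact h (solvesRow_of_ne hj.symm (by omega) fun i => hp i (Finset.mem_univ _))

theorem not_implies_iff {m n : ℕ} [NeZero n] {A : Matrix (Fin m) (Fin n) ℤ} {l : Fin n → ℤ} :
    ¬ Implies A l ↔ ∃ k, ∃ x, Solves A x ∧ ∀ j, j ≠ k → l k + x k < l j + x j := by
  simp only [Implies, not_forall, not_solvesRow_iff]
  constructor
  · rintro ⟨x, hx, k, h⟩
    exact ⟨k, x, hx, h⟩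
  · rintro ⟨k, x, hx, h⟩
    exact ⟨x, hx, k, h⟩

theorem implies_zero_iff {m : ℕ} {A : Matrix (Fin m) (Fin 0) ℤ} {l : Fin 0 → ℤ} :
    Implies A l ↔ m ≠ 0 := by
  constructor
  · rintro h rfl
    obtain ⟨k, -⟩ := h (fun _ => 0) (fun i => i.elim0)
    exact k.elim0
  · intro hm x hx
    obtain ⟨k, -⟩ := hx ⟨0, Nat.pos_of_ne_zero hm⟩
    exact k.elim0

/-- A row with two additional columns in front. -/
abbrev extend {n : ℕ} (a b : ℤ) (r : Fin n → ℤ) : Fin (n + 2) → ℤ :=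
  Fin.cons a (Fin.cons b r)

theorem forall_fin_add_two {n : ℕ} {P : Fin (n + 2) → Prop} :
    (∀ j, P j) ↔ P 0 ∧ P 1 ∧ ∀ j : Fin n, P j.succ.succ := by
  rw [Fin.forall_fin_succ, Fin.forall_fin_succ]
  rfl

/-- The row in which the column `j` has its coefficient in `l` and all other columns of `l`
have the larger coefficients `g`. -/
abbrev single {n : ℕ} (l g : Fin n → ℤ) (j : Fin n) : Fin n → ℤ :=
  Function.update g j (l j)

theorem exists_extended_solution {n : ℕ} {R : Set (Fin n → ℤ)} {l g : Fin n → ℤ} {M : ℤ}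
    {k : Fin n} (hg : ∀ i, l i < g i) (hM : ∀ r ∈ R, r k - l k < M) {x : Fin n → ℤ}
    (hx : ∀ r ∈ R, SolvesRow r x) (hk : ∀ j, j ≠ k → l k + x k < l j + x j) :
    ∃ y : Fin (n + 2) → ℤ, (∀ r ∈ R, SolvesRow (extend M M r) y) ∧
      (∀ j, SolvesRow (extend (if j = k then 0 else 1) 1 (single l g j)) y) ∧
      SolvesRow (extend 0 0 l) y := by
  refine ⟨extend (l k + x k) (l k + x k) x, fun r hr => ?_, fun j => ?_, ?_⟩
  · obtain ⟨p, q, hpq, he, hmin⟩ := hx r hr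
    have h1 := hM r hr
    have h2 := hmin k
    refine solvesRow_of_ne (p := p.succ.succ) (q := q.succ.succ) (by simpa using hpq.ne)
      (by simpa using he) ?_
    rw [forall_fin_add_two]
    refine ⟨?_, ?_, fun j => by simpa using hmin j⟩ <;>
      simp [Fin.cons_one] <;> omega
  · have hgk := hg k
    by_cases hj : j = k
    · subst hj
      refine solvesRow_of_ne (p := 0) (q := j.succ.succ) (Fin.succ_ne_zero _).symm
        (by simp) ?_
      rw [forall_fin_add_two]
      refine ⟨by simp, by simp [Fin.cons_one], fun i => ?_⟩
      by_cases hi : i = j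
      · subst hi; simp
      · have := hg i
        have := hk i hi
        simp [Function.update_of_ne hi]
        omega
    · refine solvesRow_of_ne (p := 0) (q := 1) (by simp)
        (by simp [hj, Fin.cons_one]) ?_
      rw [forall_fin_add_two]
      refine ⟨by simp, by simp [hj, Fin.cons_one], fun i => ?_⟩
      by_cases hi : i = j
      · subst hi
        have := hk i hj
        simp [hj]
        omega
      · have := hg i
        by_cases hik : i = k
        · subst hik
          simp [hj, Function.update_of_ne hi]
          omega
        · have := hk i hik
          simp [hj, Function.update_of_ne hi]
          omega
  · refine solvesRow_of_ne (p := 0) (q := 1) (by simp)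
      (by simp [Fin.cons_one]) ?_
    rw [forall_fin_add_two]
    refine ⟨by simp, by simp [Fin.cons_one], fun i => ?_⟩
    by_cases hi : i = k
    · subst hi; simp
    · have := hk i hi
      simp
      omega

theorem exists_solution_of_extended {n : ℕ} {R : Set (Fin n → ℤ)} {l g : Fin n → ℤ} {M : ℤ}
    {k : Fin n} (hg : ∀ i, l i < g i) (hM : ∀ r ∈ R, r k - l k < M) {y : Fin (n + 2) → ℤ}
    (hR : ∀ r ∈ R, SolvesRow (extend M M r) y)
    (hS : ∀ j, SolvesRow (extend (if j = k then 0 else 1) 1 (single l g j)) y)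
    (hZ : SolvesRow (extend 0 0 l) y) :
    ∃ x : Fin n → ℤ, (∀ r ∈ R, SolvesRow r x) ∧ ∀ j, j ≠ k → l k + x k < l j + x j := by
  obtain ⟨u, v, x, rfl⟩ : ∃ u v x, y = extend u v x :=
    ⟨y 0, y 1, fun j => y j.succ.succ, by
      funext j; revert j; rw [forall_fin_add_two]; exact ⟨rfl, rfl, fun _ => rfl⟩⟩
  have key : ∀ j, j ≠ k → min (min u v) (l k + x k) < l j + x j := by
    by_contra hcon
    push Not at hcon
    obtain ⟨i, hik, hi⟩ := hcon
    obtain ⟨j, hj, hmin⟩ := Finset.exists_min_image (Finset.univ.filter (· ≠ k))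
      (fun j => l j + x j) ⟨i, by simpa using hik⟩
    have hjk : j ≠ k := by simpa using hj
    have hji := hmin i (by simpa using hik)
    refine not_solvesRow_of_lt j.succ.succ ?_ (hS j)
    rw [forall_fin_add_two]
    have hgk := hg k
    refine ⟨fun _ => ?_, fun _ => ?_, fun p hp => ?_⟩
    · simp [hjk]; omega
    · simp [hjk, Fin.cons_one]; omega
    · have hpj : p ≠ j := fun h => hp (h ▸ rfl)
      have := hg p
      by_cases hpk : p = k
      · subst hpk
        simp [Function.update_of_ne hpj]
        omega
      · have := hmin p (by simpa using hpk)
        simp [Function.update_of_ne hpj]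
        omega
  have hSk := hS k
  have hu : l k + x k ≤ u ∧ l k + x k ≤ v := by
    by_contra hcon
    by_cases huv : u ≤ v
    · refine not_solvesRow_of_lt 0 ?_ hSk
      rw [forall_fin_add_two]
      refine ⟨by simp, fun _ => by simp [Fin.cons_one]; omega, fun p _ => ?_⟩
      by_cases hp : p = k
      · subst hp; simp; omega
      · have := key p hp
        have := hg p
        simp [Function.update_of_ne hp]; omega
    · refine not_solvesRow_of_lt 1 ?_ hZ
      rw [forall_fin_add_two]
      refine ⟨fun _ => by simp [Fin.cons_one]; omega, by simp, fun p _ => ?_⟩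
      by_cases hp : p = k
      · subst hp; simp [Fin.cons_one]; omega
      · have := key p hp
        simp [Fin.cons_one]; omega
  refine ⟨x, fun r hr => ?_, fun j hj => by have := key j hj; omega⟩
  have h1 := hM r hr
  obtain ⟨p, q, hpq, he, hmin⟩ := hR r hr
  have hk := hmin k.succ.succ
  have hp : ∀ s : Fin (n + 2), (extend M M r : Fin (n + 2) → ℤ) s + (extend u v x) s ≤
      r k + x k → ∃ t : Fin n, s = t.succ.succ := by
    rw [forall_fin_add_two]
    refine ⟨fun h => ?_, fun h => ?_, fun j _ => ⟨j, rfl⟩⟩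
    · simp at h; omega
    · simp [Fin.cons_one] at h; omega
  obtain ⟨p, rfl⟩ := hp p hk
  obtain ⟨q, rfl⟩ := hp q (he ▸ hk)
  exact solvesRow_of_ne (p := p) (q := q) (by rintro rfl; exact hpq.ne rfl) (by simpa using he)
    fun j => by simpa using hmin j.succ.succ

/-! ### The encoding -/

/-- The word of an integer without its closing mark. -/
def intWord (z : ℤ) : List Sym :=
  (if z < 0 then [Sym.minus] else []) ++ z.natAbs.bits.map (fun b => if b then Sym.one else Sym.zero)

theorem encodeInt_eq (z : ℤ) : encodeInt z = intWord z ++ [Sym.sep] := rfl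

theorem digitWord_subset {l : List Bool} {s : Sym}
    (h : s ∈ l.map (fun b => if b then Sym.one else Sym.zero)) : s = Sym.one ∨ s = Sym.zero := by
  obtain ⟨b, -, rfl⟩ := List.mem_map.1 h
  cases b <;> simp

theorem mem_intWord {z : ℤ} {s : Sym} (h : s ∈ intWord z) : s ≠ Sym.sep ∧ s ≠ Sym.eol := by
  rw [intWord, List.mem_append] at h
  rcases h with h | h
  · split_ifs at h <;> simp_all
  · rcases digitWord_subset h with rfl | rfl <;> simp

theorem bits_injective : Function.Injective Nat.bits := by
  intro a b h
  rw [← Nat.digits_inj_iff (b := 2), Nat.digits_two_eq_bits, Nat.digits_two_eq_bits, h]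

theorem intWord_injective : Function.Injective intWord := by
  have hd : Function.Injective (List.map (fun b : Bool => if b then Sym.one else Sym.zero)) :=
    List.map_injective_iff.2 (by intro a b; cases a <;> cases b <;> simp)
  have hm (l l' : List Bool) : Sym.minus :: l.map (fun b => if b then Sym.one else Sym.zero) ≠
      l'.map (fun b => if b then Sym.one else Sym.zero) := by
    intro h
    have := digitWord_subset (h ▸ List.mem_cons_self)
    simp at this
  intro a b h
  unfold intWord at h
  split_ifs at h with ha hb hb
  · have := bits_injective (hd (List.append_cancel_left h))
    omega
  · exact absurd h (hm _ _)
  · exact absurd h.symm (hm _ _)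
  · have := bits_injective (hd (List.append_cancel_left h))
    omega

theorem append_cons_inj {α : Type*} {a : α} {u u' s s' : List α} (hu : a ∉ u) (hu' : a ∉ u')
    (h : u ++ a :: s = u' ++ a :: s') : u = u' ∧ s = s' := by
  induction u generalizing u' with
  | nil =>
    cases u' with
    | nil => simpa using h
    | cons b u' => simp_all
  | cons b u ih =>
    cases u' with
    | nil =>
      simp only [List.cons_append, List.nil_append, List.cons.injEq] at h
      exact absurd (h.1 ▸ List.mem_cons_self) hu
    | cons b' u' =>
      simp only [List.cons_append, List.cons.injEq, List.mem_cons, not_or] at h hu hu'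
      obtain ⟨rfl, rfl⟩ := ih hu.2 hu'.2 h.2
      simp [h.1]

theorem encodeInt_append_inj {z z' : ℤ} {s s' : List Sym}
    (h : encodeInt z ++ s = encodeInt z' ++ s') : z = z' ∧ s = s' := by
  simp only [encodeInt_eq, List.append_assoc, List.cons_append, List.nil_append] at h
  have := append_cons_inj (fun h => (mem_intWord h).1 rfl) (fun h => (mem_intWord h).1 rfl) h
  exact ⟨intWord_injective this.1, this.2⟩

theorem encodeRow_eq {n : ℕ} (a : Fin n → ℤ) :
    encodeRow a = (List.ofFn a).flatMap encodeInt ++ [Sym.eol] := by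
  rw [encodeRow, List.flatMap_def, List.map_ofFn]
  rfl

theorem encodeRow_cons {n : ℕ} (z : ℤ) (a : Fin n → ℤ) :
    encodeRow (Fin.cons z a : Fin (n + 1) → ℤ) = encodeInt z ++ encodeRow a := by
  simp [encodeRow_eq]

theorem encodeRow_append_inj {n : ℕ} {a a' : Fin n → ℤ} {s s' : List Sym}
    (h : encodeRow a ++ s = encodeRow a' ++ s') : a = a' ∧ s = s' := by
  induction n with
  | zero =>
    refine ⟨Subsingleton.elim _ _, ?_⟩
    simpa [encodeRow] using h
  | succ n ih =>
    rw [← Fin.cons_self_tail a, ← Fin.cons_self_tail a'] at h ⊢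
    rw [encodeRow_cons, encodeRow_cons, List.append_assoc, List.append_assoc] at h
    obtain ⟨h1, h2⟩ := encodeInt_append_inj h
    obtain ⟨h3, h4⟩ := ih h2
    exact ⟨by rw [h1, h3], h4⟩

theorem flatMap_encodeRow_injective {n : ℕ} :
    Function.Injective (fun rows : List (Fin n → ℤ) => rows.flatMap encodeRow) := by
  intro rows
  induction rows with
  | nil =>
    rintro (_ | ⟨r, rows⟩) h
    · rfl
    · simp [encodeRow] at h
  | cons r rows ih =>
    rintro (_ | ⟨r', rows'⟩) h
    · simp [encodeRow] at h
    · simp only [List.flatMap_cons] at h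
      obtain ⟨rfl, h'⟩ := encodeRow_append_inj h
      rw [ih (a₂ := rows') h']

theorem encodeMatrix_eq {m n : ℕ} (A : Matrix (Fin m) (Fin n) ℤ) :
    encodeMatrix A =
      List.replicate n Sym.sep ++ Sym.eol :: (List.ofFn fun i => A i).flatMap encodeRow := by
  unfold encodeMatrix
  rw [List.flatMap_def, List.map_ofFn, List.append_assoc]
  rfl

theorem mem_language_tropSolv_iff {n : ℕ} {rows : List (Fin n → ℤ)} :
    List.replicate n Sym.sep ++ Sym.eol :: rows.flatMap encodeRow ∈ tropSolv.language ↔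
      ∃ x, ∀ r ∈ rows, SolvesRow r x := by
  constructor
  · rintro ⟨⟨m, n', A⟩, henc, x, hx⟩
    change encodeMatrix A = _ at henc
    rw [encodeMatrix_eq] at henc
    obtain ⟨h1, h2⟩ := append_cons_inj (by simp) (by simp) henc
    obtain rfl : n' = n := by simpa using congrArg List.length h1
    obtain rfl := flatMap_encodeRow_injective h2
    exact ⟨x, fun r hr => by obtain ⟨i, rfl⟩ := (List.mem_ofFn' _ _).1 hr; exact hx i⟩
  · rintro ⟨x, hx⟩
    refine ⟨⟨rows.length, n, Matrix.of rows.get⟩, ?_, x, fun i => hx _ (List.get_mem _ _)⟩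
    exact (encodeMatrix_eq _).trans (congrArg
      (fun L => List.replicate n Sym.sep ++ Sym.eol :: L.flatMap encodeRow) (List.ofFn_get rows))

/-- The word of a large coefficient: an additional leading digit replaces the sign. -/
def enlarge : Sym → List Sym
  | .minus => []
  | .sep => [.one, .sep]
  | s => [s]

theorem exists_bits_append_true (n : ℕ) : ∃ c, n < c ∧ c.bits = n.bits ++ [true] := by
  induction n using Nat.binaryRec' with
  | zero => exact ⟨1, by simp⟩
  | bit b n h ih =>
    obtain ⟨c, hc, hb⟩ := ih
    refine ⟨Nat.bit b c, ?_, ?_⟩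
    · cases b <;> simp [Nat.bit] <;> omega
    · rw [Nat.bits_append_bit _ _ (by omega), Nat.bits_append_bit _ _ h, hb]
      rfl

theorem exists_encodeInt_eq_enlarge (z : ℤ) :
    ∃ c : ℤ, z < c ∧ encodeInt c = (encodeInt z).flatMap enlarge := by
  obtain ⟨c, hc, hb⟩ := exists_bits_append_true z.natAbs
  refine ⟨c, by omega, ?_⟩
  have h1 : ((if z < 0 then [Sym.minus] else []) : List Sym).flatMap enlarge = [] := by
    split_ifs <;> rfl
  have h2 (l : List Bool) : (l.map (fun b => if b then Sym.one else Sym.zero)).flatMap enlarge =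
      l.map (fun b => if b then Sym.one else Sym.zero) := by
    induction l with
    | nil => rfl
    | cons b l ih => cases b <;> simp [enlarge, ih]
  rw [encodeInt, encodeInt, List.flatMap_append, List.flatMap_append, h1, h2, Int.natAbs_natCast,
    hb]
  simp [enlarge]

/-- A coefficient above `z`, with a word that is easily found from that of `z`. -/
noncomputable def bigger (z : ℤ) : ℤ := (exists_encodeInt_eq_enlarge z).choose

theorem lt_bigger (z : ℤ) : z < bigger z := (exists_encodeInt_eq_enlarge z).choose_spec.1

theorem encodeInt_bigger (z : ℤ) : encodeInt (bigger z) = (encodeInt z).flatMap enlarge :=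
  (exists_encodeInt_eq_enlarge z).choose_spec.2

theorem encodeInt_two_pow_sub_one (N : ℕ) :
    encodeInt ((2 : ℤ) ^ N - 1) = List.replicate N Sym.one ++ [Sym.sep] := by
  have h : (2 ^ N - 1).bits = List.replicate N true := by
    induction N with
    | zero => simp
    | succ N ih =>
      have : 2 ^ (N + 1) - 1 = 2 * (2 ^ N - 1) + 1 := by
        have := Nat.one_le_two_pow (n := N)
        rw [pow_succ]; omega
      rw [this, Nat.bit1_bits, ih, List.replicate_succ]
  have h1 : ((2 : ℤ) ^ N - 1) = ((2 ^ N - 1 : ℕ) : ℤ) := by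
    rw [Nat.cast_sub Nat.one_le_two_pow, Nat.cast_pow, Nat.cast_one, Nat.cast_ofNat]
  rw [h1, encodeInt, Int.natAbs_natCast, h, if_neg (by omega)]
  simp

theorem abs_lt_two_pow_length (z : ℤ) : |z| < 2 ^ ((encodeInt z).length - 1) := by
  have h1 : z.natAbs.size ≤ (encodeInt z).length - 1 := by
    simp [encodeInt, Nat.size_eq_bits_len]
  have h2 := Nat.lt_size_self z.natAbs
  have h3 : z.natAbs < 2 ^ ((encodeInt z).length - 1) :=
    h2.trans_le (Nat.pow_le_pow_right two_pos h1)
  rw [Int.abs_eq_natAbs]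
  exact_mod_cast h3

theorem sub_lt_two_pow_sub_one {a b : ℤ} {N : ℕ} (ha : (encodeInt a).length + 1 ≤ N)
    (hb : (encodeInt b).length + 1 ≤ N) : a - b < 2 ^ N - 1 := by
  have key (z : ℤ) (hz : (encodeInt z).length + 1 ≤ N) : |z| < 2 ^ (N - 2) :=
    (abs_lt_two_pow_length z).trans_le (pow_le_pow_right₀ (by norm_num) (by omega))
  have h1 := abs_lt.1 (key a ha)
  have h2 := abs_lt.1 (key b hb)
  have hpos : 0 < (encodeInt a).length := by simp [encodeInt]
  obtain ⟨K, rfl⟩ : ∃ K, N = K + 2 := ⟨N - 2, by omega⟩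
  have h3 : (1 : ℤ) ≤ 2 ^ K := one_le_pow₀ (by norm_num)
  have h4 : (2 : ℤ) ^ (K + 2) = 4 * 2 ^ K := by ring
  simp only [Nat.add_sub_cancel] at h1 h2
  omega

/-! ### A structured language for stack machines -/

instance : Fintype Sym where
  elems := {.zero, .one, .minus, .sep, .eol}
  complete x := by cases x <;> decide

/-- The stacks of the reduction machine. -/
inductive Stack : Type
  | inp | qry | ones | line | tmp | aux | left | right | cnt | ans
  deriving DecidableEq

instance : Fintype Stack where
  elems := {.inp, .qry, .ones, .line, .tmp, .aux, .left, .right, .cnt, .ans}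
  complete x := by cases x <;> decide

/-- The contents of the stacks. -/
abbrev Store := Stack → List Sym

/-- Structured programs. `loop k last f` pops `k`, runs `f` on the symbol (`none` if the stack was
empty), and repeats this until the symbol satisfies `last`. -/
inductive Code : Type
  | skip
  | push (k : Stack) (a : Sym)
  | seq (c d : Code)
  | loop (k : Stack) (last : Option Sym → Bool) (f : Option Sym → Code)
  | query (c d : Code)

namespace Code

/-- The control states of a program. -/
def Pos : Code → Type
  | skip => Empty
  | push _ _ => Unit
  | seq c d => c.Pos ⊕ d.Pos
  | loop _ _ f => Option (Σ o, (f o).Pos)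
  | query c d => Option (c.Pos ⊕ d.Pos)

theorem finite_pos (c : Code) : Finite c.Pos := by
  induction c with
  | skip => exact inferInstanceAs (Finite Empty)
  | push => exact inferInstanceAs (Finite Unit)
  | seq c d hc hd => exact inferInstanceAs (Finite (c.Pos ⊕ d.Pos))
  | loop k last f hf => exact inferInstanceAs (Finite (Option (Σ o, (f o).Pos)))
  | query c d hc hd => exact inferInstanceAs (Finite (Option (c.Pos ⊕ d.Pos)))

variable {Q : Type}

/-- The first state of a program whose states are embedded in `Q` and which continues with
`exit`. -/
def entry : (c : Code) → (c.Pos → Q) → Q → Q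
  | skip, _, exit => exit
  | push _ _, e, _ => e ()
  | seq c d, e, exit => c.entry (fun p => e (.inl p)) (d.entry (fun p => e (.inr p)) exit)
  | loop _ _ _, e, _ => e none
  | query _ _, e, _ => e none

/-- The instructions of a program. -/
def instr : (c : Code) → (c.Pos → Q) → Q → c.Pos → Instr Stack Q
  | push k a, _, exit, _ => .push k a exit
  | seq c d, e, exit, .inl p =>
      c.instr (fun p => e (.inl p)) (d.entry (fun p => e (.inr p)) exit) p
  | seq _ d, e, exit, .inr p => d.instr (fun p => e (.inr p)) exit p
  | loop k last f, e, exit, none =>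
      .pop k fun o => (f o).entry (fun p => e (some ⟨o, p⟩)) (if last o then exit else e none)
  | loop _ last f, e, exit, some ⟨o, p⟩ =>
      (f o).instr (fun p => e (some ⟨o, p⟩)) (if last o then exit else e none) p
  | query c d, e, exit, none =>
      .query (c.entry (fun p => e (some (.inl p))) exit) (d.entry (fun p => e (some (.inr p))) exit)
  | query c _, e, exit, some (.inl p) => c.instr (fun p => e (some (.inl p))) exit p
  | query _ d, e, exit, some (.inr p) => d.instr (fun p => e (some (.inr p))) exit p

/-- The oracle machine of a program; it accepts if `ans` is not empty at the end. -/
noncomputable def machine (c : Code) : OracleMachine where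
  K := Stack
  Q := c.Pos ⊕ Option Bool
  finQ := have := c.finite_pos; Fintype.ofFinite _
  inputStack := .inp
  queryStack := .qry
  start := c.entry Sum.inl (.inr none)
  prog
    | .inl p => c.instr Sum.inl (.inr none) p
    | .inr none => .pop .ans fun o => .inr (some o.isSome)
    | .inr (some b) => .halt b

end Code

/-- `Exec O c σ σ' T N`: with oracle `O`, the program `c` leads from `σ` to `σ'` in at most `T`
steps and with at most `N` queries. -/
inductive Exec (O : Set (List Sym)) : Code → Store → Store → ℕ → ℕ → Prop
  | skip {σ} : Exec O .skip σ σ 0 0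
  | push {k a σ} : Exec O (.push k a) σ (Function.update σ k (a :: σ k)) 1 0
  | seq {c d σ σ₁ σ₂ T T' N N'} : Exec O c σ σ₁ T N → Exec O d σ₁ σ₂ T' N' →
      Exec O (.seq c d) σ σ₂ (T + T') (N + N')
  | last {k last f σ σ' T N} : last (σ k).head? = true →
      Exec O (f (σ k).head?) (Function.update σ k (σ k).tail) σ' T N →
      Exec O (.loop k last f) σ σ' (T + 1) N
  | next {k last f σ σ₁ σ₂ T T' N N'} : last (σ k).head? = false →
      Exec O (f (σ k).head?) (Function.update σ k (σ k).tail) σ₁ T N →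
      Exec O (.loop k last f) σ₁ σ₂ T' N' →
      Exec O (.loop k last f) σ σ₂ (T' + (T + 1)) (N' + N)
  | query_yes {c d σ σ' T N} : σ .qry ∈ O → Exec O c (Function.update σ .qry []) σ' T N →
      Exec O (.query c d) σ σ' (T + 1) (N + 1)
  | query_no {c d σ σ' T N} : σ .qry ∉ O → Exec O d (Function.update σ .qry []) σ' T N →
      Exec O (.query c d) σ σ' (T + 1) (N + 1)
  | mono {c σ σ' T N T' N'} : Exec O c σ σ' T N → T ≤ T' → N ≤ N' → Exec O c σ σ' T' N'

namespace OracleMachine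

variable (M : OracleMachine) (O : Set (List Sym))

/-- The state makes a query. -/
def IsQuery (q : M.Q) : Prop := ∃ q₁ q₂ : M.Q, M.prog q = .query q₁ q₂

open Classical in
/-- The number of queries in the first `t` steps from `c`. -/
noncomputable def queriesFrom (c : M.Cfg) (t : ℕ) : ℕ :=
  ∑ s ∈ Finset.range t, if M.IsQuery ((M.step O)^[s] c).state then 1 else 0

theorem queriesFrom_add (c : M.Cfg) (s t : ℕ) :
    M.queriesFrom O c (s + t) = M.queriesFrom O c s + M.queriesFrom O ((M.step O)^[s] c) t := by
  rw [queriesFrom, Finset.sum_range_add]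
  congr 1
  refine Finset.sum_congr rfl fun r _ => ?_
  rw [add_comm, Function.iterate_add_apply]

/-- Within `T` steps and with at most `N` queries the machine comes from `c` to `c'`. -/
def Reaches (c c' : M.Cfg) (T N : ℕ) : Prop :=
  ∃ t ≤ T, (M.step O)^[t] c = c' ∧ M.queriesFrom O c t ≤ N

variable {M O}

theorem Reaches.refl (c : M.Cfg) : M.Reaches O c c 0 0 := ⟨0, le_rfl, rfl, by simp [queriesFrom]⟩

theorem Reaches.trans {c₁ c₂ c₃ : M.Cfg} {T T' N N' : ℕ} (h : M.Reaches O c₁ c₂ T N)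
    (h' : M.Reaches O c₂ c₃ T' N') : M.Reaches O c₁ c₃ (T + T') (N + N') := by
  obtain ⟨t, ht, rfl, hN⟩ := h
  obtain ⟨t', ht', rfl, hN'⟩ := h'
  refine ⟨t + t', by omega, ?_, ?_⟩
  · rw [add_comm, Function.iterate_add_apply]
  · rw [queriesFrom_add]; omega

theorem Reaches.mono {c c' : M.Cfg} {T T' N N' : ℕ} (h : M.Reaches O c c' T N) (hT : T ≤ T')
    (hN : N ≤ N') : M.Reaches O c c' T' N' := by
  obtain ⟨t, ht, h, hN₁⟩ := h
  exact ⟨t, ht.trans hT, h, hN₁.trans hN⟩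

theorem reaches_push {q next : M.Q} {k : M.K} {a : Sym} (h : M.prog q = .push k a next)
    (σ : M.K → List Sym) :
    M.Reaches O ⟨q, σ⟩ ⟨next, Function.update σ k (a :: σ k)⟩ 1 0 :=
  ⟨1, le_rfl, by simp [step, h], by simp [queriesFrom, IsQuery, h]⟩

theorem reaches_pop {q : M.Q} {k : M.K} {next : Option Sym → M.Q} (h : M.prog q = .pop k next)
    (σ : M.K → List Sym) :
    M.Reaches O ⟨q, σ⟩ ⟨next (σ k).head?, Function.update σ k (σ k).tail⟩ 1 0 :=
  ⟨1, le_rfl, by simp [step, h], by simp [queriesFrom, IsQuery, h]⟩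

theorem reaches_query_yes {q q₁ q₂ : M.Q} (h : M.prog q = .query q₁ q₂) {σ : M.K → List Sym}
    (hO : σ M.queryStack ∈ O) :
    M.Reaches O ⟨q, σ⟩ ⟨q₁, Function.update σ M.queryStack []⟩ 1 1 :=
  ⟨1, le_rfl, by simp [step, h, hO], by simp [queriesFrom, IsQuery, h]⟩

theorem reaches_query_no {q q₁ q₂ : M.Q} (h : M.prog q = .query q₁ q₂) {σ : M.K → List Sym}
    (hO : σ M.queryStack ∉ O) :
    M.Reaches O ⟨q, σ⟩ ⟨q₂, Function.update σ M.queryStack []⟩ 1 1 :=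
  ⟨1, le_rfl, by simp [step, h, hO], by simp [queriesFrom, IsQuery, h]⟩

theorem queryCount_eq (w : List Sym) (t : ℕ) :
    M.queryCount O w t = M.queriesFrom O (M.init w) t := by
  classical
  rw [queryCount, queriesFrom, Finset.card_filter]
  refine Finset.sum_congr rfl fun s _ => ?_
  unfold IsQuery run
  congr

theorem iterate_step_of_halt {c : M.Cfg} {b : Bool} (h : M.prog c.state = .halt b) (t : ℕ) :
    (M.step O)^[t] c = c :=
  Function.iterate_fixed (by simp [step, h]) t

theorem Reaches.queriesFrom_le {c c' : M.Cfg} {T N : ℕ} (h : M.Reaches O c c' T N) {b : Bool}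
    (hb : M.prog c'.state = .halt b) (t : ℕ) : M.queriesFrom O c t ≤ N := by
  obtain ⟨s, -, rfl, hN⟩ := h
  have h0 : M.queriesFrom O ((M.step O)^[s] c) t = 0 := by
    refine Finset.sum_eq_zero fun r _ => if_neg ?_
    rw [iterate_step_of_halt hb]
    rintro ⟨q₁, q₂, hq⟩
    rw [hb] at hq
    cases hq
  calc M.queriesFrom O c t ≤ M.queriesFrom O c (t + s) := by rw [queriesFrom_add]; omega
    _ = M.queriesFrom O c s := by rw [add_comm, queriesFrom_add, h0, add_zero]
    _ ≤ N := hN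

end OracleMachine

open OracleMachine

theorem Exec.reaches {O : Set (List Sym)} {c : Code} {σ σ' : Store} {T N : ℕ}
    (h : Exec O c σ σ' T N) (M : Code) (e : c.Pos → M.machine.Q) (exit : M.machine.Q)
    (he : ∀ p, M.machine.prog (e p) = c.instr e exit p) :
    M.machine.Reaches O ⟨c.entry e exit, σ⟩ ⟨exit, σ'⟩ T N := by
  induction h generalizing exit with
  | skip => exact Reaches.refl _
  | push => exact reaches_push (he ()) _
  | seq _ _ ih₁ ih₂ =>
    exact (ih₁ _ _ fun p => he (.inl p)).trans (ih₂ _ _ fun p => he (.inr p))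
  | @last k last f σ σ' T N hs _ ih =>
    have h1 := ih (fun p => e (some ⟨_, p⟩)) (if last (σ k).head? then exit else e none)
      fun p => he (some ⟨_, p⟩)
    have h2 := (reaches_pop (O := O) (he none) σ).trans h1
    rw [if_pos hs] at h2
    exact h2.mono (by omega) (by omega)
  | @next k last f σ σ₁ σ₂ T T' N N' hs _ _ ih₁ ih₂ =>
    have h1 := ih₁ (fun p => e (some ⟨_, p⟩)) (if last (σ k).head? then exit else e none)
      fun p => he (some ⟨_, p⟩)
    have h2 := (reaches_pop (O := O) (he none) σ).trans h1
    rw [if_neg (by simp [hs])] at h2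
    exact (h2.trans (ih₂ e exit he)).mono (by omega) (by omega)
  | query_yes hO _ ih =>
    exact ((reaches_query_yes (he none) hO).trans
      (ih (fun p => e (some (.inl p))) exit fun p => he (some (.inl p)))).mono (by omega) (by omega)
  | query_no hO _ ih =>
    exact ((reaches_query_no (he none) hO).trans
      (ih (fun p => e (some (.inr p))) exit fun p => he (some (.inr p)))).mono (by omega) (by omega)
  | mono _ hT hN ih => exact (ih e exit he).mono hT hN

/-- The store with `w` on the input stack. -/
def inputStore (w : List Sym) : Store := Function.update (fun _ => []) .inp w

theorem Exec.machine_reaches {O : Set (List Sym)} {c : Code} {w : List Sym} {σ : Store} {T N : ℕ}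
    (h : Exec O c (inputStore w) σ T N) :
    ∃ c' : c.machine.Cfg, c.machine.prog c'.state = .halt (σ .ans).head?.isSome ∧
      c.machine.Reaches O (c.machine.init w) c' (T + 1) N := by
  have h1 := h.reaches c Sum.inl (.inr none) fun p => rfl
  exact ⟨_, rfl, h1.trans (reaches_pop (M := c.machine) (k := Stack.ans) rfl σ)⟩

theorem Exec.haltsWithin {O : Set (List Sym)} {c : Code} {w : List Sym} {σ : Store} {T N : ℕ}
    (h : Exec O c (inputStore w) σ T N) :
    c.machine.HaltsWithin O w (T + 1) (σ .ans).head?.isSome := by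
  obtain ⟨c', hc', t, ht, rfl, -⟩ := h.machine_reaches
  exact ⟨t, ht, hc'⟩

theorem Exec.queryCount_le {O : Set (List Sym)} {c : Code} {w : List Sym} {σ : Store} {T N : ℕ}
    (h : Exec O c (inputStore w) σ T N) (t : ℕ) : c.machine.queryCount O w t ≤ N := by
  obtain ⟨c', hc', hr⟩ := h.machine_reaches
  rw [queryCount_eq]
  exact hr.queriesFrom_le hc' t

/-! ### Programs that move words between allStacks -/

namespace Code

/-- Put the word `w` on top of the stack `k`. -/
def pushes (k : Stack) : List Sym → Code
  | [] => skip
  | a :: w => seq (pushes k w) (push k a)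

/-- All allStacks. -/
def allStacks : List Stack :=
  [.inp, .qry, .ones, .line, .tmp, .aux, .left, .right, .cnt, .ans]

/-- Put the word `β k` on top of every stack `k`. -/
def pushAll (β : Stack → List Sym) : Code :=
  allStacks.foldr (fun k c => seq (pushes k (β k)) c) skip

/-- The total length of the words `β k`. -/
def size (β : Stack → List Sym) : ℕ := (allStacks.map fun k => (β k).length).sum

/-- Pop symbols from `a` until a symbol that satisfies `last`, and for every symbol `s` before put
the word `β k s` on top of every stack `k`. -/
def walk (a : Stack) (last : Option Sym → Bool) (β : Stack → Sym → List Sym) : Code :=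
  loop a last fun o =>
    match o with
    | none => skip
    | some s => if last (some s) then skip else pushAll fun k => β k s

/-- Pop one symbol and run the program that belongs to it. -/
def pop (k : Stack) (f : Option Sym → Code) : Code := loop k (fun _ => true) f

/-- The condition that the given symbol has been found. -/
def at_ (s : Sym) : Option Sym → Bool := fun o => decide (o = some s)

end Code

open Code

variable {O : Set (List Sym)}

theorem Exec.to {c : Code} {σ σ' τ τ' : Store} {T T' N N' : ℕ} (h : Exec O c σ σ' T N)
    (h₁ : τ = σ) (h₂ : σ' = τ') (hT : T ≤ T') (hN : N ≤ N') : Exec O c τ τ' T' N' := by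
  subst h₁ h₂
  exact h.mono hT hN

theorem Exec.pushes (k : Stack) (w : List Sym) (σ : Store) :
    Exec O (pushes k w) σ (Function.update σ k (w ++ σ k)) w.length 0 := by
  induction w with
  | nil => exact Exec.skip.to rfl (by simp) le_rfl le_rfl
  | cons a w ih => exact (ih.seq Exec.push).to rfl (by simp) (by simp) le_rfl

theorem Exec.pushAll (β : Stack → List Sym) (σ : Store) :
    Exec O (pushAll β) σ (fun k => β k ++ σ k) (size β) 0 := by
  have key (ks : List Stack) (hks : ks.Nodup) (σ : Store) :
      Exec O (ks.foldr (fun k c => Code.seq (Code.pushes k (β k)) c) Code.skip) σ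
        (fun k => if k ∈ ks then β k ++ σ k else σ k)
        (ks.map fun k => (β k).length).sum 0 := by
    induction ks generalizing σ with
    | nil => exact Exec.skip.to rfl (by simp) le_rfl le_rfl
    | cons k ks ih =>
      rw [List.nodup_cons] at hks
      refine ((Exec.pushes k (β k) σ).seq (ih hks.2 _)).to rfl ?_ (by simp) le_rfl
      funext i
      by_cases hi : i = k
      · subst hi; simp [hks.1]
      · simp [hi]
  refine (key allStacks (by decide) σ).to rfl ?_ le_rfl le_rfl
  funext k
  rw [if_pos (by cases k <;> decide)]

theorem Exec.loop_none {k : Stack} {last : Option Sym → Bool} {f : Option Sym → Code}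
    {σ σ' : Store} {T N : ℕ} (hk : σ k = []) (hs : last none = true)
    (h : Exec O (f none) σ σ' T N) : Exec O (loop k last f) σ σ' (T + 1) N := by
  refine Exec.last (by rw [hk]; exact hs) ?_
  rw [hk, List.tail_nil, ← hk, Function.update_eq_self, hk]
  exact h

theorem Exec.loop_last {k : Stack} {last : Option Sym → Bool} {f : Option Sym → Code}
    {σ σ' : Store} {T N : ℕ} {s : Sym} {w : List Sym} (hk : σ k = s :: w)
    (hs : last (some s) = true) (h : Exec O (f (some s)) (Function.update σ k w) σ' T N) :
    Exec O (loop k last f) σ σ' (T + 1) N := by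
  refine Exec.last (by rw [hk]; exact hs) ?_
  rw [hk]
  exact h

theorem Exec.loop_next {k : Stack} {last : Option Sym → Bool} {f : Option Sym → Code}
    {σ σ₁ σ₂ : Store} {T T' N N' : ℕ} {s : Sym} {w : List Sym} (hk : σ k = s :: w)
    (hs : last (some s) = false) (h : Exec O (f (some s)) (Function.update σ k w) σ₁ T N)
    (h' : Exec O (loop k last f) σ₁ σ₂ T' N') :
    Exec O (loop k last f) σ σ₂ (T' + (T + 1)) (N' + N) := by
  refine Exec.next (by rw [hk]; exact hs) ?_ h'
  rw [hk]
  exact h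

theorem Exec.loop_append {a : Stack} {last : Option Sym → Bool} {f : Option Sym → Code}
    {β : Stack → Sym → List Sym} {u v : List Sym} {σ σ' : Store} {T N : ℕ} (hσ : σ a = u ++ v)
    (hf : ∀ s ∈ u, last (some s) = false ∧ f (some s) = Code.pushAll fun k => β k s)
    (hβ : ∀ s, size (β · s) ≤ 4) (ha : ∀ s, β a s = [])
    (h : Exec O (loop a last f) (fun k => if k = a then v else u.reverse.flatMap (β k) ++ σ k)
      σ' T N) : Exec O (loop a last f) σ σ' (T + 5 * u.length) N := by
  induction u generalizing σ with
  | nil =>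
    refine h.to (funext fun k => ?_) rfl le_rfl le_rfl
    by_cases hk : k = a
    · subst hk; simpa using hσ
    · simp [hk]
  | cons s u ih =>
    obtain ⟨hs, hfs⟩ := hf s List.mem_cons_self
    refine (Exec.loop_next (w := u ++ v) hσ hs (hfs ▸ Exec.pushAll _ _) (ih ?_ ?_ ?_)).to rfl rfl
      ?_ le_rfl
    · simp [ha]
    · exact fun s hs => hf s (List.mem_cons_of_mem _ hs)
    · refine h.to (funext fun k => ?_) rfl le_rfl le_rfl
      by_cases hk : k = a
      · simp [hk]
      · simp [hk]
    · have := hβ s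
      simp only [List.length_cons]
      omega

theorem Exec.walk {a : Stack} {last : Option Sym → Bool} {β : Stack → Sym → List Sym}
    {u v : List Sym} {σ : Store} (hσ : σ a = u ++ v) (hu : ∀ s ∈ u, last (some s) = false)
    (hv : last v.head? = true) (hβ : ∀ s, size (β · s) ≤ 4) (ha : ∀ s, β a s = []) :
    Exec O (walk a last β) σ
      (fun k => if k = a then v.tail else u.reverse.flatMap (β k) ++ σ k)
      (5 * u.length + 1) 0 := by
  refine (Exec.loop_append (T := 1) (N := 0) hσ (fun s hs => ⟨hu s hs, by simp [hu s hs]⟩) hβ ha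
    ?_).mono (by omega) le_rfl
  cases v with
  | nil => exact Exec.loop_none (by simp) hv Exec.skip
  | cons s v =>
    refine (Exec.loop_last (s := s) (w := v) (T := 0) (by simp) hv ?_).to rfl rfl le_rfl le_rfl
    simp only [List.head?_cons] at hv
    simp only [hv, if_true]
    refine Exec.skip.to rfl (funext fun k => ?_) le_rfl le_rfl
    by_cases hk : k = a
    · subst hk; simp
    · simp [hk]

/-- The store with the given contents. -/
def store (inp qry ones line tmp aux left right cnt ans : List Sym) : Store
  | .inp => inp
  | .qry => qry
  | .ones => ones
  | .line => line
  | .tmp => tmp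
  | .aux => aux
  | .left => left
  | .right => right
  | .cnt => cnt
  | .ans => ans

/-! ### The program of the reduction -/

namespace Code

/-- Reverse the input, and find a large number. -/
def reverseInput : Code :=
  walk .inp Option.isNone fun k s => match k with
    | .tmp => [s]
    | .ones => [.one]
    | _ => []

/-- Find the last row of the input, count its entries, and put it, with two zeros in front, on
`right`. -/
def readLine : Code :=
  seq (pop .tmp fun _ => push .right .eol) <|
  seq (walk .tmp (at_ .eol) fun k s => match k with
    | .right => [s]
    | .line => [s]
    | .cnt => if s = .sep then [.sep] else []
    | _ => []) <|
  pushes .right [.sep, .sep]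

/-- Put the large number two times in front of a row. -/
def extendRow : Code :=
  seq (push .inp .sep) <|
  seq (walk .ones Option.isNone fun k s => match k with
    | .inp => [s]
    | .aux => [s]
    | _ => []) <|
  seq (push .inp .sep) <|
  seq (walk .aux Option.isNone fun k s => match k with
    | .inp => [s]
    | .ones => [s]
    | _ => []) <|
  push .inp .eol

/-- Add two columns with a large number to the matrix. -/
def extendMatrix : Code :=
  seq (push .inp .eol) <|
  loop .tmp Option.isNone fun o => match o with
    | none => pushes .inp [.sep, .sep]
    | some .eol => extendRow
    | some s => pushAll fun k => match k with
      | .inp => [s]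
      | _ => []

/-- Put the first part of the queries on `left`. -/
def moveLeft : Code :=
  walk .inp Option.isNone fun k s => match k with
    | .left => [s]
    | _ => []

/-- Put the row on `right` in which only the marked entry of `line` is not enlarged, and move the
mark to the next entry. -/
def makeRow : Code :=
  seq (push .right .eol) <|
  seq (walk .line (at_ .eol) fun k s => match k with
    | .aux => [s]
    | .tmp => (enlarge s).reverse
    | _ => []) <|
  seq (walk .line (at_ .sep) fun k s => match k with
    | .aux => [s]
    | .tmp => [s]
    | _ => []) <|
  seq (pushes .aux [.eol, .sep]) <|
  seq (push .tmp .sep) <|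
  seq (walk .line Option.isNone fun k s => match k with
    | .aux => [s]
    | .tmp => (enlarge s).reverse
    | _ => []) <|
  seq (walk .aux Option.isNone fun k s => match k with
    | .line => [s]
    | _ => []) <|
  seq (walk .tmp Option.isNone fun k s => match k with
    | .right => [s]
    | _ => []) <|
  pushes .right [.one, .sep, .one, .sep]

/-- Make the rows for all entries. -/
def makeRows : Code :=
  seq (push .line .eol) <|
  loop .cnt Option.isNone fun o => match o with
    | none => skip
    | some _ => makeRow

/-- Ask the oracle about the word on `left` and `right`. If the answer is no, move on to the next
row. -/
def ask : Code :=
  seq (walk .right Option.isNone fun k s => match k with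
    | .tmp => [s]
    | _ => []) <|
  seq (walk .tmp Option.isNone fun k s => match k with
    | .right => [s]
    | .qry => [s]
    | _ => []) <|
  seq (walk .left Option.isNone fun k s => match k with
    | .tmp => [s]
    | .qry => [s]
    | _ => []) <|
  seq (walk .tmp Option.isNone fun k s => match k with
    | .left => [s]
    | _ => []) <|
  query (push .right .minus) <|
  seq (push .left .one) <|
  seq (walk .right (at_ .eol) fun k s => match k with
    | .left => [s]
    | _ => []) <|
  push .left .eol

/-- Ask the oracle for all rows until the first positive answer. -/
def askAll : Code :=
  loop .right (fun o => decide (o ≠ some .one)) fun o => match o with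
    | some .one => ask
    | some .sep => push .ans .one
    | _ => skip

/-- The reduction, with an extra treatment of inputs without columns. -/
def reduction : Code :=
  pop .inp fun o => match o with
    | none => skip
    | some .eol => seq (pop .inp fun _ => skip) <| pop .inp fun o => match o with
      | none => skip
      | some _ => push .ans .one
    | some s => seq (push .inp s) <| seq reverseInput <| seq readLine <| seq extendMatrix <|
      seq moveLeft <| seq makeRows askAll

end Code

theorem flatMap_const_one (w : List Sym) :
    (w.flatMap fun _ => [Sym.one]) = List.replicate w.length .one := by
  induction w <;> simp_all [List.replicate_succ]

theorem flatMap_const_nil (w : List Sym) : (w.flatMap fun _ => ([] : List Sym)) = [] := by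
  induction w <;> simp_all

theorem exec_reverseInput (w : List Sym) :
    Exec O reverseInput (store w [] [] [] [] [] [] [] [] [])
      (store [] [] (List.replicate w.length .one) [] w.reverse [] [] [] [] [])
      (5 * w.length + 1) 0 := by
  refine (Exec.walk (u := w) (v := []) (by simp [store]) (by simp) rfl
    (by intro s; cases s <;> decide) (fun _ => rfl)).to rfl ?_ le_rfl le_rfl
  funext k
  cases k <;> simp [store, flatMap_const_one]

theorem exec_readLine {u v ones : List Sym} (hu : .eol ∉ u) :
    Exec O readLine (store [] [] ones [] (.eol :: u.reverse ++ .eol :: v) [] [] [] [] [])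
      (store [] [] ones u v [] [] (.sep :: .sep :: u ++ [.eol])
        (List.replicate (u.count .sep) .sep) []) (5 * u.length + 5) 0 := by
  have h1 : Exec O (pop .tmp fun _ => .push .right .eol)
      (store [] [] ones [] (.eol :: u.reverse ++ .eol :: v) [] [] [] [] [])
      (store [] [] ones [] (u.reverse ++ .eol :: v) [] [] [.eol] [] []) 2 0 := by
    refine (Exec.loop_last rfl rfl Exec.push).to rfl ?_ le_rfl le_rfl
    funext k; cases k <;> rfl
  refine (h1.seq ((Exec.walk (u := u.reverse) (v := .eol :: v) rfl ?_ (by simp [at_])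
    (by intro s; cases s <;> decide) (fun _ => rfl)).seq (Exec.pushes _ _ _))).to rfl ?_ ?_ le_rfl
  · intro s hs
    simp only [at_, Option.some.injEq, decide_eq_false_iff_not]
    rintro rfl
    exact hu (by simpa using hs)
  · have hc : (u.flatMap fun s => if s = Sym.sep then [Sym.sep] else []) =
        List.replicate (u.count .sep) .sep := by
      clear hu h1
      induction u with
      | nil => rfl
      | cons s u ih =>
        rw [List.flatMap_cons, ih]
        by_cases h : s = .sep
        · subst h; simp [List.replicate_succ]
        · rw [List.count_cons_of_ne h]; simp [h]
    funext k
    cases k <;> simp [store, flatMap_const_nil, hc]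
  · simp; omega

theorem exec_extendRow (N : ℕ) (inp line tmp right cnt : List Sym) :
    Exec O extendRow (store inp [] (List.replicate N .one) line tmp [] [] right cnt [])
      (store (.eol :: (List.replicate N .one ++ .sep :: (List.replicate N .one ++ .sep :: inp))) []
        (List.replicate N .one) line tmp [] [] right cnt []) (10 * N + 5) 0 := by
  have h1 : Exec O (Code.walk .ones Option.isNone fun k s => match k with
      | .inp => [s]
      | .aux => [s]
      | _ => [])
      (store (.sep :: inp) [] (List.replicate N .one) line tmp [] [] right cnt [])
      (store (List.replicate N .one ++ .sep :: inp) [] [] line tmp (List.replicate N .one)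
        [] right cnt []) (5 * N + 1) 0 := by
    refine (Exec.walk (u := List.replicate N .one) (v := []) (by simp [store]) (by simp) rfl
      (by intro s; cases s <;> decide) (fun _ => rfl)).to rfl ?_ (by simp) le_rfl
    funext k
    cases k <;> simp [store, List.flatMap_def]
  have h2 : Exec O (Code.walk .aux Option.isNone fun k s => match k with
      | .inp => [s]
      | .ones => [s]
      | _ => [])
      (store (.sep :: (List.replicate N .one ++ .sep :: inp)) [] [] line tmp
        (List.replicate N .one) [] right cnt [])
      (store (List.replicate N .one ++ .sep :: (List.replicate N .one ++ .sep :: inp)) []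
        (List.replicate N .one) line tmp [] [] right cnt []) (5 * N + 1) 0 := by
    refine (Exec.walk (u := List.replicate N .one) (v := []) (by simp [store]) (by simp) rfl
      (by intro s; cases s <;> decide) (fun _ => rfl)).to rfl ?_ (by simp) le_rfl
    funext k
    cases k <;> simp [store, List.flatMap_def]
  have hp (s : Sym) (inp ones line tmp aux right cnt : List Sym) : Exec O (.push .inp s)
      (store inp [] ones line tmp aux [] right cnt [])
      (store (s :: inp) [] ones line tmp aux [] right cnt []) 1 0 := by
    refine Exec.push.to rfl ?_ le_rfl le_rfl
    funext k; cases k <;> rfl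
  exact ((hp _ _ _ _ _ _ _ _).seq (h1.seq ((hp _ _ _ _ _ _ _ _).seq
    (h2.seq (hp _ _ _ _ _ _ _ _))))).mono (by omega) le_rfl

/-- A header and rows (the last one first), read backwards. -/
def revText (n : ℕ) : List (List Sym) → List Sym
  | [] => List.replicate n .sep
  | r :: rs => r.reverse ++ .eol :: revText n rs

theorem exec_extendMatrix_loop (N n : ℕ) (line right cnt : List Sym) (rs : List (List Sym))
    (hrs : ∀ r ∈ rs, .eol ∉ r) (acc : List Sym) :
    Exec O (loop .tmp Option.isNone fun o => match o with
        | none => Code.pushes .inp [.sep, .sep]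
        | some .eol => extendRow
        | some s => Code.pushAll fun k => match k with
          | .inp => [s]
          | _ => [])
      (store (.eol :: acc) [] (List.replicate N .one) line (revText n rs) [] [] right cnt [])
      (store (List.replicate (n + 2) .sep ++ .eol :: (rs.reverse.flatMap fun r =>
        List.replicate N .one ++ .sep :: (List.replicate N .one ++ .sep :: (r ++ [.eol])))
          ++ acc) [] (List.replicate N .one) line [] [] [] right cnt [])
      (5 * (revText n rs).length + rs.length * (10 * N + 6) + 3) 0 := by
  induction rs generalizing acc with
  | nil =>
    refine (Exec.loop_append (u := List.replicate n .sep) (v := [])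
      (β := fun k s => match k with
          | .inp => [s]
          | _ => []) (T := 3) (N := 0) (by simp [store, revText]) ?_
      (by intro s; cases s <;> decide) (fun _ => rfl) ?_).mono (by simp [revText]; omega) le_rfl
    · intro s hs
      rw [List.eq_of_mem_replicate hs]
      exact ⟨rfl, rfl⟩
    · refine (Exec.loop_none (by simp) rfl (Exec.pushes _ _ _)).to rfl ?_ (by simp) le_rfl
      funext k
      cases k <;> simp [store, flatMap_const_nil, List.replicate_succ]
  | cons r rs ih =>
    have hr := hrs r List.mem_cons_self
    refine (Exec.loop_append (u := r.reverse) (v := .eol :: revText n rs)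
      (β := fun k s => match k with
          | .inp => [s]
          | _ => []) (T := 5 * (revText n rs).length + rs.length * (10 * N + 6) + 3 + (10 * N + 6))
      (N := 0) (by simp [store, revText]) ?_
      (by intro s; cases s <;> decide) (fun _ => rfl) ?_).mono
      (by simp [revText, Nat.add_mul]; omega) le_rfl
    · intro s hs
      refine ⟨rfl, ?_⟩
      cases s <;> first | rfl | exact absurd (by simpa using hs) hr
    · refine (Exec.loop_next (s := .eol) (w := revText n rs) (by simp) rfl
        ((exec_extendRow N (r ++ .eol :: acc) line (revText n rs) right cnt).to ?_ rfl le_rfl le_rfl)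
        (ih (fun r hr => hrs r (List.mem_cons_of_mem _ hr)) _)).to rfl ?_ (by omega) le_rfl
      · funext k
        cases k <;> simp [store, flatMap_const_nil]
      · simp

theorem exec_extendMatrix (N n : ℕ) (line right cnt : List Sym) (rs : List (List Sym))
    (hrs : ∀ r ∈ rs, .eol ∉ r) :
    Exec O extendMatrix
      (store [] [] (List.replicate N .one) line (revText n rs) [] [] right cnt [])
      (store (List.replicate (n + 2) .sep ++ .eol :: rs.reverse.flatMap fun r =>
        List.replicate N .one ++ .sep :: (List.replicate N .one ++ .sep :: (r ++ [.eol])))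
          [] (List.replicate N .one) line [] [] [] right cnt [])
      (5 * (revText n rs).length + rs.length * (10 * N + 6) + 4) 0 := by
  refine (Exec.push.seq ((exec_extendMatrix_loop N n line right cnt rs hrs []).to ?_ rfl le_rfl
    le_rfl)).to rfl (by simp) (by omega) le_rfl
  funext k; cases k <;> rfl

theorem exec_moveLeft (w ones line right cnt : List Sym) :
    Exec O moveLeft (store w [] ones line [] [] [] right cnt [])
      (store [] [] ones line [] [] w.reverse right cnt []) (5 * w.length + 1) 0 := by
  refine (Exec.walk (u := w) (v := []) (by simp [store]) (by simp) rfl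
    (by intro s; cases s <;> decide) (fun _ => rfl)).to rfl ?_ le_rfl le_rfl
  funext k
  cases k <;> simp [store, flatMap_const_nil]

theorem length_flatMap_enlarge_le (w : List Sym) : (w.flatMap enlarge).length ≤ 2 * w.length := by
  induction w with
  | nil => simp
  | cons s w ih =>
    have : (enlarge s).length ≤ 2 := by cases s <;> decide
    simp only [List.flatMap_cons, List.length_append, List.length_cons]
    omega

theorem exec_makeRow {u e v : List Sym} (hu : .eol ∉ u) (he : .sep ∉ e)
    (ones left right cnt : List Sym) :
    Exec O makeRow
      (store [] [] ones (u ++ .eol :: (e ++ .sep :: v)) [] [] left right cnt [])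
      (store [] [] ones (u ++ e ++ .sep :: .eol :: v) [] [] left
        (.one :: .sep :: .one :: .sep :: (u.flatMap enlarge ++ (e ++ .sep :: (v.flatMap enlarge ++
          .eol :: right)))) cnt [])
      (20 * (u.length + e.length + v.length + 2)) 0 := by
  have h0 : Exec O (.push .right .eol)
      (store [] [] ones (u ++ .eol :: (e ++ .sep :: v)) [] [] left right cnt [])
      (store [] [] ones (u ++ .eol :: (e ++ .sep :: v)) [] [] left (.eol :: right) cnt []) 1 0 := by
    refine Exec.push.to rfl ?_ le_rfl le_rfl
    funext k; cases k <;> rfl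
  have h1 : Exec O (Code.walk .line (at_ .eol) fun k s => match k with
      | .aux => [s]
      | .tmp => (enlarge s).reverse
      | _ => [])
      (store [] [] ones (u ++ .eol :: (e ++ .sep :: v)) [] [] left (.eol :: right) cnt [])
      (store [] [] ones (e ++ .sep :: v) (u.flatMap enlarge).reverse u.reverse left (.eol :: right)
        cnt []) (5 * u.length + 1) 0 := by
    refine (Exec.walk (u := u) (v := .eol :: (e ++ .sep :: v)) rfl ?_ (by simp [at_])
      (by intro s; cases s <;> decide) (fun _ => rfl)).to rfl ?_ le_rfl le_rfl
    · intro s hs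
      simp only [at_, Option.some.injEq, decide_eq_false_iff_not]
      rintro rfl
      exact hu hs
    · funext k
      cases k <;> simp [store, flatMap_const_nil, List.reverse_flatMap, Function.comp_def]
  have h2 : Exec O (Code.walk .line (at_ .sep) fun k s => match k with
      | .aux => [s]
      | .tmp => [s]
      | _ => [])
      (store [] [] ones (e ++ .sep :: v) (u.flatMap enlarge).reverse u.reverse left (.eol :: right)
        cnt [])
      (store [] [] ones v (e.reverse ++ (u.flatMap enlarge).reverse) (e.reverse ++ u.reverse) left
        (.eol :: right) cnt []) (5 * e.length + 1) 0 := by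
    refine (Exec.walk (u := e) (v := .sep :: v) rfl ?_ (by simp [at_])
      (by intro s; cases s <;> decide) (fun _ => rfl)).to rfl ?_ le_rfl le_rfl
    · intro s hs
      simp only [at_, Option.some.injEq, decide_eq_false_iff_not]
      rintro rfl
      exact he hs
    · funext k
      cases k <;> simp [store, flatMap_const_nil]
  have h3 : Exec O (Code.walk .line Option.isNone fun k s => match k with
      | .aux => [s]
      | .tmp => (enlarge s).reverse
      | _ => [])
      (store [] [] ones v (.sep :: (e.reverse ++ (u.flatMap enlarge).reverse))
        (.eol :: .sep :: (e.reverse ++ u.reverse)) left (.eol :: right) cnt [])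
      (store [] [] ones [] ((v.flatMap enlarge).reverse ++
        .sep :: (e.reverse ++ (u.flatMap enlarge).reverse))
        (v.reverse ++ .eol :: .sep :: (e.reverse ++ u.reverse)) left (.eol :: right) cnt [])
      (5 * v.length + 1) 0 := by
    refine (Exec.walk (u := v) (v := []) (by simp [store]) (by simp) rfl
      (by intro s; cases s <;> decide) (fun _ => rfl)).to rfl ?_ le_rfl le_rfl
    funext k
    cases k <;> simp [store, flatMap_const_nil, List.reverse_flatMap, Function.comp_def]
  have h4 (a t right : List Sym) : Exec O (Code.walk .aux Option.isNone fun k s => match k with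
      | .line => [s]
      | _ => []) (store [] [] ones [] t a left right cnt [])
      (store [] [] ones a.reverse t [] left right cnt []) (5 * a.length + 1) 0 := by
    refine (Exec.walk (u := a) (v := []) (by simp [store]) (by simp) rfl
      (by intro s; cases s <;> decide) (fun _ => rfl)).to rfl ?_ le_rfl le_rfl
    funext k
    cases k <;> simp [store, flatMap_const_nil]
  have h5 (l t right : List Sym) : Exec O (Code.walk .tmp Option.isNone fun k s => match k with
      | .right => [s]
      | _ => []) (store [] [] ones l t [] left right cnt [])
      (store [] [] ones l [] [] left (t.reverse ++ right) cnt []) (5 * t.length + 1) 0 := by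
    refine (Exec.walk (u := t) (v := []) (by simp [store]) (by simp) rfl
      (by intro s; cases s <;> decide) (fun _ => rfl)).to rfl ?_ le_rfl le_rfl
    funext k
    cases k <;> simp [store, flatMap_const_nil]
  have hp (w l t a right : List Sym) : Exec O (Code.pushes .aux w)
      (store [] [] ones l t a left right cnt [])
      (store [] [] ones l t (w ++ a) left right cnt []) w.length 0 := by
    refine (Exec.pushes _ _ _).to rfl ?_ le_rfl le_rfl
    funext k; cases k <;> rfl
  have hq (l t a right : List Sym) : Exec O (Code.push .tmp .sep)
      (store [] [] ones l t a left right cnt [])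
      (store [] [] ones l (.sep :: t) a left right cnt []) 1 0 := by
    refine Exec.push.to rfl ?_ le_rfl le_rfl
    funext k; cases k <;> rfl
  have hu2 := length_flatMap_enlarge_le u
  have hv2 := length_flatMap_enlarge_le v
  refine (h0.seq (h1.seq (h2.seq ((hp _ _ _ _ _).seq ((hq _ _ _ _).seq (h3.seq ((h4 _ _ _).seq
    ((h5 _ _ _).seq (Exec.pushes _ _ _))))))))).to rfl ?_ ?_ le_rfl
  · funext k
    cases k <;> simp [store]
  · simp only [List.length_append, List.length_reverse, List.length_cons, List.length_nil]
    omega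

theorem encodeInt_one : encodeInt 1 = [.one, .sep] := by simp [encodeInt]

theorem encodeInt_zero : encodeInt 0 = [Sym.sep] := by simp [encodeInt]

theorem flatMap_encodeInt_bigger (ls : List ℤ) :
    (ls.map bigger).flatMap encodeInt = (ls.flatMap encodeInt).flatMap enlarge := by
  rw [List.flatMap_map, List.flatMap_assoc]
  exact congrArg (ls.flatMap ·) (funext encodeInt_bigger)

theorem encodeRow_single {n : ℕ} (l : Fin n → ℤ) (j : Fin n) :
    encodeRow (single l (fun i => bigger (l i)) j) =
      (((List.ofFn l).take j).flatMap encodeInt).flatMap enlarge ++ (intWord (l j) ++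
        Sym.sep :: ((((List.ofFn l).drop (j + 1)).flatMap encodeInt).flatMap enlarge ++ [Sym.eol])) := by
  have h : List.ofFn (single l (fun i => bigger (l i)) j) =
      ((List.ofFn l).take j).map bigger ++ l j :: ((List.ofFn l).drop (j + 1)).map bigger := by
    have h1 : List.ofFn (single l (fun i => bigger (l i)) j) =
        ((List.ofFn l).map bigger).set j (l j) := by
      refine List.ext_getElem (by simp) fun i h1 h2 => ?_
      rw [List.getElem_set]
      simp [single, Function.update_apply, Fin.ext_iff, eq_comm]
    rw [h1, List.set_eq_take_append_cons_drop, if_pos (by simp), List.map_take, List.map_drop]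
  rw [encodeRow_eq, h, List.flatMap_append, List.flatMap_cons, flatMap_encodeInt_bigger,
    flatMap_encodeInt_bigger, encodeInt_eq]
  simp

theorem eol_not_mem_flatMap_encodeInt (ls : List ℤ) : Sym.eol ∉ ls.flatMap encodeInt := by
  intro h
  obtain ⟨z, -, hz⟩ := List.mem_flatMap.1 h
  rw [encodeInt_eq, List.mem_append] at hz
  rcases hz with hz | hz
  · exact (mem_intWord hz).2 rfl
  · simp at hz

theorem exec_makeRows_loop {n : ℕ} (l : Fin n → ℤ) (ones left : List Sym) (c j : ℕ)
    (hc : j + c = n) (right : List Sym) :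
    Exec O (loop .cnt Option.isNone fun o => match o with
        | none => skip
        | some _ => makeRow)
      (store [] [] ones (((List.ofFn l).take j).flatMap encodeInt ++
        Sym.eol :: ((List.ofFn l).drop j).flatMap encodeInt) [] [] left right
          (List.replicate c .sep) [])
      (store [] [] ones ((List.ofFn l).flatMap encodeInt ++ [Sym.eol]) [] [] left
        (((List.finRange n).drop j).reverse.flatMap
          (fun i => encodeRow (extend 1 1 (single l (fun i => bigger (l i)) i))) ++ right) [] [])
      (c * (20 * (((List.ofFn l).flatMap encodeInt).length + 2) + 1) + 1) 0 := by
  induction c generalizing j right with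
  | zero =>
    obtain rfl : j = n := by omega
    refine (Exec.loop_none rfl rfl Exec.skip).to rfl ?_ (by omega) le_rfl
    have h1 : (List.ofFn l).take j = List.ofFn l := List.take_of_length_le (by simp)
    have h2 : (List.ofFn l).drop j = [] := List.drop_of_length_le (by simp)
    have h3 : (List.finRange j).drop j = [] := List.drop_of_length_le (by simp)
    rw [h1, h2, h3]
    rfl
  | succ c ih =>
    have hj : j < n := by omega
    have hd : (List.ofFn l).drop j = l ⟨j, hj⟩ :: (List.ofFn l).drop (j + 1) := by
      rw [List.drop_eq_getElem_cons (by simpa using hj)]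
      simp
    have ht : (List.ofFn l).take (j + 1) = (List.ofFn l).take j ++ [l ⟨j, hj⟩] := by
      rw [List.take_succ_eq_append_getElem (by simpa using hj)]
      simp
    have hf : (List.finRange n).drop j = ⟨j, hj⟩ :: (List.finRange n).drop (j + 1) := by
      rw [List.drop_eq_getElem_cons (by simpa using hj)]
      simp
    have hrow := exec_makeRow (O := O) (u := ((List.ofFn l).take j).flatMap encodeInt)
      (e := intWord (l ⟨j, hj⟩)) (v := ((List.ofFn l).drop (j + 1)).flatMap encodeInt)
      (eol_not_mem_flatMap_encodeInt _) (fun h => (mem_intWord h).1 rfl) ones left right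
      (List.replicate c .sep)
    have hlen : ((List.ofFn l).flatMap encodeInt).length =
        (((List.ofFn l).take j).flatMap encodeInt).length + (intWord (l ⟨j, hj⟩)).length + 1 +
          (((List.ofFn l).drop (j + 1)).flatMap encodeInt).length := by
      conv_lhs => rw [← List.take_append_drop j (List.ofFn l), hd]
      simp [encodeInt_eq]
      omega
    refine (Exec.loop_next rfl rfl (hrow.to ?_ ?_ le_rfl le_rfl) (ih (j + 1) (by omega)
      (encodeRow (extend 1 1 (single l (fun i => bigger (l i)) ⟨j, hj⟩)) ++ right))).to rfl ?_ ?_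
      le_rfl
    · rw [hd]
      funext k
      cases k <;> simp [store, encodeInt_eq]
    · rw [ht, encodeRow_cons, encodeRow_cons, encodeInt_one, encodeRow_single]
      funext k
      cases k <;> simp [store, encodeInt_eq]
    · rw [hf]
      simp
    · rw [hlen]
      ring_nf
      omega

theorem exec_makeRows {n : ℕ} (l : Fin n → ℤ) (ones left right : List Sym) :
    Exec O makeRows
      (store [] [] ones ((List.ofFn l).flatMap encodeInt) [] [] left right
        (List.replicate n .sep) [])
      (store [] [] ones ((List.ofFn l).flatMap encodeInt ++ [Sym.eol]) [] [] left
        ((List.finRange n).reverse.flatMap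
          (fun i => encodeRow (extend 1 1 (single l (fun i => bigger (l i)) i))) ++ right) [] [])
      (n * (20 * (((List.ofFn l).flatMap encodeInt).length + 2) + 1) + 2) 0 := by
  refine (Exec.push.seq ((exec_makeRows_loop l ones left n 0 (by omega) right).to ?_ rfl le_rfl
    le_rfl)).to rfl (by simp) (by omega) le_rfl
  funext k; cases k <;> rfl

open Classical in
/-- Copying `left` and `right` to the query stack, and the query. -/
theorem exec_ask (P R line ones : List Sym) {σ : Store} {T N : ℕ}
    (h : Exec O (if P ++ R ∈ O then .push .right .minus else
        seq (.push .left .one) <| seq (Code.walk .right (at_ .eol) fun k s => match k with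
          | .left => [s]
          | _ => []) <| .push .left .eol)
      (store [] [] ones line [] [] P.reverse R [] []) σ T N) :
    Exec O ask (store [] [] ones line [] [] P.reverse R [] []) σ
      (10 * (P.length + R.length) + 5 + T) (N + 1) := by
  have h1 : Exec O (Code.walk .right Option.isNone fun k s => match k with
      | .tmp => [s]
      | _ => []) (store [] [] ones line [] [] P.reverse R [] [])
      (store [] [] ones line R.reverse [] P.reverse [] [] []) (5 * R.length + 1) 0 := by
    refine (Exec.walk (u := R) (v := []) (by simp [store]) (by simp) rfl
      (by intro s; cases s <;> decide) (fun _ => rfl)).to rfl ?_ le_rfl le_rfl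
    funext k
    cases k <;> simp [store, flatMap_const_nil]
  have h2 : Exec O (Code.walk .tmp Option.isNone fun k s => match k with
      | .right => [s]
      | .qry => [s]
      | _ => []) (store [] [] ones line R.reverse [] P.reverse [] [] [])
      (store [] R ones line [] [] P.reverse R [] []) (5 * R.length + 1) 0 := by
    refine (Exec.walk (u := R.reverse) (v := []) (by simp [store]) (by simp) rfl
      (by intro s; cases s <;> decide) (fun _ => rfl)).to rfl ?_ (by simp) le_rfl
    funext k
    cases k <;> simp [store, flatMap_const_nil]
  have h3 : Exec O (Code.walk .left Option.isNone fun k s => match k with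
      | .tmp => [s]
      | .qry => [s]
      | _ => []) (store [] R ones line [] [] P.reverse R [] [])
      (store [] (P ++ R) ones line P [] [] R [] []) (5 * P.length + 1) 0 := by
    refine (Exec.walk (u := P.reverse) (v := []) (by simp [store]) (by simp) rfl
      (by intro s; cases s <;> decide) (fun _ => rfl)).to rfl ?_ (by simp) le_rfl
    funext k
    cases k <;> simp [store, flatMap_const_nil]
  have h4 : Exec O (Code.walk .tmp Option.isNone fun k s => match k with
      | .left => [s]
      | _ => []) (store [] (P ++ R) ones line P [] [] R [] [])
      (store [] (P ++ R) ones line [] [] P.reverse R [] []) (5 * P.length + 1) 0 := by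
    refine (Exec.walk (u := P) (v := []) (by simp [store]) (by simp) rfl
      (by intro s; cases s <;> decide) (fun _ => rfl)).to rfl ?_ (by simp) le_rfl
    funext k
    cases k <;> simp [store, flatMap_const_nil]
  have hq : store [] [] ones line [] [] P.reverse R [] [] =
      Function.update (store [] (P ++ R) ones line [] [] P.reverse R [] []) .qry [] := by
    funext k; cases k <;> rfl
  rw [hq] at h
  have h5 : Exec O (query (.push .right .minus) (seq (.push .left .one) <|
      seq (Code.walk .right (at_ .eol) fun k s => match k with
        | .left => [s]
        | _ => []) <| .push .left .eol))
      (store [] (P ++ R) ones line [] [] P.reverse R [] []) σ (T + 1) (N + 1) := by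
    by_cases hO : P ++ R ∈ O
    · rw [if_pos hO] at h
      exact Exec.query_yes hO h
    · rw [if_neg hO] at h
      exact Exec.query_no hO h
  exact (h1.seq (h2.seq (h3.seq (h4.seq h5)))).mono (by omega) (by omega)

theorem exec_askAll {ι : Type*} [DecidableEq ι] (body : ι → List Sym) (hbody : ∀ i, .eol ∉ body i)
    (P z line ones : List Sym) (B : ℕ) (js done : List ι) (hnd : (done ++ js).Nodup)
    (hB : (P ++ (done ++ js).flatMap (fun i => Sym.one :: (body i ++ [Sym.eol])) ++ Sym.sep :: z).length
      ≤ B) :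
    ∃ σ, Exec O askAll
        (store [] [] ones line [] [] (P ++ done.flatMap fun i => Sym.one :: (body i ++ [Sym.eol])).reverse
          ((js.flatMap fun i => Sym.one :: (body i ++ [Sym.eol])) ++ Sym.sep :: z) [] []) σ
        (js.length * (15 * B + 12) + 2) js.length ∧
      ((σ .ans).head?.isSome ↔ ∀ i ∈ js, P ++ (done ++ js).flatMap (fun j =>
        (if j = i then [] else [Sym.one]) ++ (body j ++ [Sym.eol])) ++ Sym.sep :: z ∉ O) := by
  induction js generalizing done with
  | nil =>
    refine ⟨_, (Exec.loop_last rfl rfl Exec.push).mono (by omega) le_rfl, ?_⟩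
    simp [store]
  | cons i js ih =>
    obtain ⟨hnd1, hnd2, hdisj⟩ := List.nodup_append.1 hnd
    have hi1 : ∀ j ∈ done, j ≠ i := fun j hj => hdisj j hj i List.mem_cons_self
    have hi2 : ∀ j ∈ js, j ≠ i := fun j hj h => (List.nodup_cons.1 hnd2).1 (h ▸ hj)
    have hcongr (ks : List ι) (hks : ∀ j ∈ ks, j ≠ i) :
        ks.flatMap (fun j => (if j = i then [] else [Sym.one]) ++ (body j ++ [Sym.eol])) =
          ks.flatMap fun j => Sym.one :: (body j ++ [Sym.eol]) := by
      rw [List.flatMap_def, List.flatMap_def]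
      congr 1
      exact List.map_congr_left fun j hj => by simp [hks j hj]
    have hQ : P ++ (done ++ i :: js).flatMap (fun j =>
        (if j = i then [] else [Sym.one]) ++ (body j ++ [Sym.eol])) ++ Sym.sep :: z =
        (P ++ done.flatMap fun i => Sym.one :: (body i ++ [Sym.eol])) ++
          (body i ++ Sym.eol :: ((js.flatMap fun i => Sym.one :: (body i ++ [Sym.eol])) ++ Sym.sep :: z)) := by
      rw [List.flatMap_append, List.flatMap_cons, hcongr _ hi1, hcongr _ hi2]
      simp
    have hlen : (P ++ done.flatMap fun i => Sym.one :: (body i ++ [Sym.eol])).length +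
        (body i ++ Sym.eol :: ((js.flatMap fun i => Sym.one :: (body i ++ [Sym.eol])) ++ Sym.sep :: z)).length
          + 1 ≤ B := by
      refine le_trans (le_of_eq ?_) hB
      simp only [List.flatMap_append, List.flatMap_cons, List.length_append, List.length_cons,
        List.length_nil]
      omega
    have hpop : store [] [] ones line [] []
        (P ++ done.flatMap fun i => Sym.one :: (body i ++ [Sym.eol])).reverse
        (body i ++ Sym.eol :: ((js.flatMap fun i => Sym.one :: (body i ++ [Sym.eol])) ++ Sym.sep :: z)) [] [] =
        Function.update (store [] [] ones line [] []
          (P ++ done.flatMap fun i => Sym.one :: (body i ++ [Sym.eol])).reverse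
          (((i :: js).flatMap fun i => Sym.one :: (body i ++ [Sym.eol])) ++ Sym.sep :: z) [] []) .right
          (body i ++ Sym.eol :: ((js.flatMap fun i => Sym.one :: (body i ++ [Sym.eol])) ++ Sym.sep :: z)) := by
      funext k; cases k <;> rfl
    have hhead : store [] [] ones line [] []
        (P ++ done.flatMap fun i => Sym.one :: (body i ++ [Sym.eol])).reverse
        (((i :: js).flatMap fun i => Sym.one :: (body i ++ [Sym.eol])) ++ Sym.sep :: z) [] [] .right =
        Sym.one :: (body i ++ Sym.eol :: ((js.flatMap fun i => Sym.one :: (body i ++ [Sym.eol])) ++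
          Sym.sep :: z)) := by
      simp [store]
    by_cases hO : P ++ (done ++ i :: js).flatMap (fun j =>
        (if j = i then [] else [Sym.one]) ++ (body j ++ [Sym.eol])) ++ Sym.sep :: z ∈ O
    · have h1 := exec_ask (O := O) _ _ line ones (by
        rw [if_pos (hQ ▸ hO)]
        exact Exec.push)
      rw [hpop] at h1
      refine ⟨_, (Exec.loop_next hhead (by simp) h1 (Exec.loop_last (Function.update_self _ _ _) (by simp)
        Exec.skip)).mono ?_ ?_, ?_⟩
      · simp only [List.length_cons, Nat.add_mul]
        omega
      · simp
      · exact iff_of_false Bool.false_ne_true fun h => h i List.mem_cons_self hO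
    · obtain ⟨σ, hσ, hans⟩ := ih (done ++ [i]) (by simpa using hnd) (by simpa using hB)
      refine ⟨σ, ?_, ?_⟩
      · have hwalk : Exec O (seq (.push .left .one) <|
            seq (Code.walk .right (at_ .eol) fun k s => match k with
              | .left => [s]
              | _ => []) <| .push .left .eol)
            (store [] [] ones line [] []
              (P ++ done.flatMap fun i => Sym.one :: (body i ++ [Sym.eol])).reverse
              (body i ++ Sym.eol :: ((js.flatMap fun i => Sym.one :: (body i ++ [Sym.eol])) ++ Sym.sep :: z))
              [] [])
            (store [] [] ones line [] []
              (P ++ (done ++ [i]).flatMap fun i => Sym.one :: (body i ++ [Sym.eol])).reverse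
              ((js.flatMap fun i => Sym.one :: (body i ++ [Sym.eol])) ++ Sym.sep :: z) [] [])
            (5 * (body i).length + 3) 0 := by
          refine (Exec.push.seq ((Exec.walk (u := body i) (v := Sym.eol ::
            ((js.flatMap fun i => Sym.one :: (body i ++ [Sym.eol])) ++ Sym.sep :: z)) (by simp [store]) ?_
            (by simp [at_]) (by intro s; cases s <;> decide) (fun _ => rfl)).seq Exec.push)).to rfl
            ?_ (by omega) le_rfl
          · intro s hs
            simp only [at_, Option.some.injEq, decide_eq_false_iff_not]
            rintro rfl
            exact hbody i hs
          · funext k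
            cases k <;> simp [store, flatMap_const_nil]
        have h1 := exec_ask (O := O) _ _ line ones (by
          rw [if_neg (hQ ▸ hO)]
          exact hwalk)
        rw [hpop] at h1
        refine (Exec.loop_next hhead (by simp) h1 hσ).mono ?_ (by simp)
        simp only [List.length_append, List.length_cons] at hlen ⊢
        ring_nf at hlen ⊢
        omega
      · rw [hans, show done ++ [i] ++ js = done ++ i :: js by simp]
        exact ⟨fun h => List.forall_mem_cons.2 ⟨hO, h⟩, fun h => (List.forall_mem_cons.1 h).2⟩

theorem reverse_header_append (n : ℕ) (rs : List (List Sym)) :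
    (List.replicate n Sym.sep ++ Sym.eol :: rs.flatMap (· ++ [Sym.eol])).reverse =
      Sym.eol :: revText n rs.reverse := by
  induction rs using List.reverseRecOn with
  | nil => simp [revText]
  | append_singleton rs r ih =>
    have h : List.replicate n Sym.sep ++ Sym.eol :: (rs ++ [r]).flatMap (· ++ [Sym.eol]) =
        (List.replicate n Sym.sep ++ Sym.eol :: rs.flatMap (· ++ [Sym.eol])) ++ (r ++ [Sym.eol]) := by simp
    rw [h, List.reverse_append, ih]
    simp [revText]

theorem count_sep_flatMap_encodeInt (ls : List ℤ) :
    (ls.flatMap encodeInt).count Sym.sep = ls.length := by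
  induction ls with
  | nil => rfl
  | cons z ls ih =>
    have : (intWord z).count Sym.sep = 0 := List.count_eq_zero.2 fun h => (mem_intWord h).1 rfl
    rw [List.flatMap_cons, List.count_append, ih, encodeInt_eq, List.count_append, this]
    simp [add_comm]

theorem length_encodeRow_single_le {n : ℕ} (l : Fin n → ℤ) (j : Fin n) :
    (encodeRow (single l (fun i => bigger (l i)) j)).length ≤
      2 * ((List.ofFn l).flatMap encodeInt).length + 1 := by
  have h1 := length_flatMap_enlarge_le (((List.ofFn l).take j).flatMap encodeInt)
  have h2 := length_flatMap_enlarge_le (((List.ofFn l).drop (j + 1)).flatMap encodeInt)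
  have hd : (List.ofFn l).drop j = l j :: (List.ofFn l).drop (j + 1) := by
    rw [List.drop_eq_getElem_cons (by simp)]
    simp
  have hlen : ((List.ofFn l).flatMap encodeInt).length =
      (((List.ofFn l).take j).flatMap encodeInt).length + (intWord (l j)).length + 1 +
        (((List.ofFn l).drop (j + 1)).flatMap encodeInt).length := by
    conv_lhs => rw [← List.take_append_drop j (List.ofFn l), hd]
    simp [encodeInt_eq]
    omega
  rw [encodeRow_single, hlen]
  simp only [List.length_append, List.length_cons, List.length_nil]
  omega

theorem length_flatMap_le {α β : Type*} (f : α → List β) (c : ℕ) (as : List α)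
    (h : ∀ a, (f a).length ≤ c) : (as.flatMap f).length ≤ as.length * c := by
  induction as with
  | nil => simp
  | cons a as ih =>
    have := h a
    rw [List.flatMap_cons, List.length_append, List.length_cons, Nat.add_mul]
    omega

theorem length_le_length_flatMap_of_mem {α β : Type*} (f : α → List β) {a : α} {as : List α}
    (h : a ∈ as) : (f a).length ≤ (as.flatMap f).length := by
  obtain ⟨s, t, rfl⟩ := List.append_of_mem h
  simp only [List.flatMap_append, List.flatMap_cons, List.length_append]
  omega

theorem length_flatMap_extended (N : ℕ) (rs : List (List Sym)) :
    (rs.flatMap fun r => List.replicate N Sym.one ++ Sym.sep :: (List.replicate N Sym.one ++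
      Sym.sep :: (r ++ [Sym.eol]))).length =
      (rs.flatMap (· ++ [Sym.eol])).length + rs.length * (2 * N + 2) := by
  induction rs with
  | nil => simp
  | cons r rs ih =>
    rw [List.flatMap_cons, List.length_append, ih]
    simp
    ring

theorem length_le_length_flatMap (rs : List (List Sym)) :
    rs.length ≤ (rs.flatMap (· ++ [Sym.eol])).length := by
  induction rs with
  | nil => simp
  | cons r rs ih => simp at ih ⊢; omega

/-- The rows of the query for the column `k`. -/
noncomputable def queryRows {n : ℕ} (rows : List (Fin n → ℤ)) (l : Fin n → ℤ) (M : ℤ) (k : Fin n) :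
    List (Fin (n + 2) → ℤ) :=
  rows.map (extend M M) ++
    (List.finRange n).reverse.map (fun j =>
      extend (if j = k then 0 else 1) 1 (single l (fun i => bigger (l i)) j)) ++ [extend 0 0 l]

theorem exists_solvesRow_queryRows_iff {n : ℕ} {rows : List (Fin n → ℤ)} {l : Fin n → ℤ} {M : ℤ}
    {k : Fin n} (hM : ∀ r ∈ rows, r k - l k < M) :
    (∃ y, ∀ r ∈ queryRows rows l M k, SolvesRow r y) ↔
      ∃ x, (∀ r ∈ rows, SolvesRow r x) ∧ ∀ j, j ≠ k → l k + x k < l j + x j := by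
  have hrows (y : Fin (n + 2) → ℤ) : (∀ r ∈ queryRows rows l M k, SolvesRow r y) ↔
      (∀ r ∈ {r | r ∈ rows}, SolvesRow (extend M M r) y) ∧
      (∀ j, SolvesRow (extend (if j = k then 0 else 1) 1 (single l (fun i => bigger (l i)) j)) y) ∧
      SolvesRow (extend 0 0 l) y := by
    simp only [queryRows, List.mem_append, List.mem_map, List.mem_reverse, List.mem_finRange,
      true_and, List.mem_singleton, or_imp, forall_and, forall_exists_index, and_imp,
      forall_apply_eq_imp_iff₂, forall_apply_eq_imp_iff, forall_eq, Set.mem_ofPred_eq, and_assoc]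
  simp only [hrows]
  constructor
  · rintro ⟨y, h1, h2, h3⟩
    exact exists_solution_of_extended (R := {r | r ∈ rows}) (fun i => lt_bigger (l i)) hM h1 h2 h3
  · rintro ⟨x, hx, hk⟩
    exact exists_extended_solution (R := {r | r ∈ rows}) (fun i => lt_bigger (l i)) hM hx hk

theorem exec_reduction {n : ℕ} (hn : n ≠ 0) (rows : List (Fin n → ℤ)) (l : Fin n → ℤ)
    {w : List Sym} (hw : List.replicate n Sym.sep ++ Sym.eol :: rows.flatMap encodeRow ++
      encodeRow l = w) :
    ∃ σ, Exec O reduction (inputStore w) σ (400 * (w.length + 1) ^ 3) n ∧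
      ((σ Stack.ans).head?.isSome ↔ ∀ k, List.replicate (n + 2) Sym.sep ++ Sym.eol ::
        (queryRows rows l (2 ^ w.length - 1) k).flatMap encodeRow ∉ O) := by
  set N := w.length with hN
  set lw := (List.ofFn l).flatMap encodeInt with hlw
  set rs : List (List Sym) := rows.map fun r => (List.ofFn r).flatMap encodeInt with hrs
  set M : ℤ := 2 ^ N - 1 with hM
  have hrows : rows.flatMap encodeRow = rs.flatMap (· ++ [Sym.eol]) := by
    rw [hrs, List.flatMap_map]
    exact congrArg (rows.flatMap ·) (funext encodeRow_eq)
  have hw' : w = List.replicate n Sym.sep ++ Sym.eol :: rs.flatMap (· ++ [Sym.eol]) ++ (lw ++ [Sym.eol]) := by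
    rw [← hw, hrows, encodeRow_eq]
  have hrev : w.reverse = Sym.eol :: lw.reverse ++ Sym.eol :: revText n rs.reverse := by
    rw [hw', List.reverse_append, reverse_header_append]
    simp
  have hlen : N = n + 1 + (rs.flatMap (· ++ [Sym.eol])).length + (lw.length + 1) := by
    rw [hN, hw']
    simp
    omega
  have hrevlen : (revText n rs.reverse).length = n + (rs.flatMap (· ++ [Sym.eol])).length := by
    have := congrArg List.length (reverse_header_append n rs)
    simp at this ⊢
    omega
  have hrslen := length_le_length_flatMap rs
  set body : Fin n → List Sym := fun j =>
    Sym.sep :: Sym.one :: Sym.sep :: (List.ofFn (single l (fun i => bigger (l i)) j)).flatMap encodeInt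
    with hbody
  set P : List Sym := List.replicate (n + 2) Sym.sep ++ Sym.eol :: rs.flatMap fun r =>
    List.replicate N Sym.one ++ Sym.sep :: (List.replicate N Sym.one ++ Sym.sep :: (r ++ [Sym.eol])) with hP
  have hrow1 (j : Fin n) : encodeRow (extend 1 1 (single l (fun i => bigger (l i)) j)) =
      Sym.one :: (body j ++ [Sym.eol]) := by
    rw [encodeRow_cons, encodeRow_cons, encodeInt_one, encodeRow_eq]
    simp [hbody]
  have hrow2 (j k : Fin n) :
      encodeRow (extend (if j = k then 0 else 1) 1 (single l (fun i => bigger (l i)) j)) =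
        (if j = k then [] else [Sym.one]) ++ (body j ++ [Sym.eol]) := by
    by_cases h : j = k
    · rw [if_pos h, if_pos h, encodeRow_cons, encodeRow_cons, encodeInt_one, encodeInt_zero,
        encodeRow_eq]
      simp [hbody]
    · rw [if_neg h, if_neg h, hrow1]
      rfl
  have hQ (k : Fin n) : List.replicate (n + 2) Sym.sep ++ Sym.eol ::
      (queryRows rows l M k).flatMap encodeRow =
      P ++ ([] ++ (List.finRange n).reverse).flatMap (fun j =>
        (if j = k then [] else [Sym.one]) ++ (body j ++ [Sym.eol])) ++ Sym.sep :: Sym.sep :: (lw ++ [Sym.eol]) := by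
    have h1 : (rows.map (extend M M)).flatMap encodeRow = rs.flatMap fun r =>
        List.replicate N Sym.one ++ Sym.sep :: (List.replicate N Sym.one ++ Sym.sep :: (r ++ [Sym.eol])) := by
      rw [hrs, List.flatMap_map, List.flatMap_map]
      refine congrArg (rows.flatMap ·) (funext fun r => ?_)
      rw [encodeRow_cons, encodeRow_cons, hM, encodeInt_two_pow_sub_one, encodeRow_eq]
      simp
    have h2 : ((List.finRange n).reverse.map (fun j =>
        extend (if j = k then 0 else 1) 1 (single l (fun i => bigger (l i)) j))).flatMap encodeRow =
        (List.finRange n).reverse.flatMap (fun j =>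
          (if j = k then [] else [Sym.one]) ++ (body j ++ [Sym.eol])) := by
      rw [List.flatMap_map]
      exact congrArg ((List.finRange n).reverse.flatMap ·) (funext fun j => hrow2 j k)
    have h3 : encodeRow (extend 0 0 l) = Sym.sep :: Sym.sep :: (lw ++ [Sym.eol]) := by
      rw [encodeRow_cons, encodeRow_cons, encodeInt_zero, encodeRow_eq]
      rfl
    rw [queryRows, List.flatMap_append, List.flatMap_append, h1, h2, List.flatMap_singleton, h3, hP]
    simp only [List.nil_append, List.append_assoc, List.cons_append]
  have hB : (P ++ ([] ++ (List.finRange n).reverse).flatMap (fun i => Sym.one :: (body i ++ [Sym.eol]))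
      ++ Sym.sep :: Sym.sep :: (lw ++ [Sym.eol])).length ≤ 9 * (N + 1) ^ 2 := by
    have h1 := length_flatMap_le (fun i => Sym.one :: (body i ++ [Sym.eol])) (2 * N + 5)
      ([] ++ (List.finRange n).reverse) (fun j => by
        have := length_encodeRow_single_le l j
        rw [encodeRow_eq, ← hlw] at this
        simp [hbody] at this ⊢
        omega)
    simp only [List.nil_append, List.length_reverse, List.length_finRange] at h1
    have h2 : n * (2 * N + 5) ≤ N * (2 * N + 5) := Nat.mul_le_mul_right _ (by omega)
    have h3 : rs.length * (2 * N + 2) ≤ N * (2 * N + 2) := Nat.mul_le_mul_right _ (by omega)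
    rw [hP, List.length_append, List.length_append, List.length_append, List.length_cons,
      length_flatMap_extended]
    simp only [List.nil_append, List.length_replicate, List.length_cons, List.length_append,
      List.length_nil]
    ring_nf at h1 h2 h3 ⊢
    omega
  obtain ⟨σ, hσ, hans⟩ := exec_askAll (O := O) body (fun j hj => by
      simp only [hbody, List.mem_cons, reduceCtorEq, false_or] at hj
      exact eol_not_mem_flatMap_encodeInt _ hj) P (Sym.sep :: (lw ++ [Sym.eol])) (lw ++ [Sym.eol])
    (List.replicate N .one) _ (List.finRange n).reverse [] (by simpa using List.nodup_finRange n) hB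
  refine ⟨σ, ?_, ?_⟩
  · obtain ⟨n', rfl⟩ : ∃ n', n = n' + 1 := ⟨n - 1, by omega⟩
    obtain ⟨w', hw''⟩ : ∃ w', w = Sym.sep :: w' := ⟨_, by rw [hw', List.replicate_succ]; rfl⟩
    have h1 := exec_reverseInput (O := O) w
    have h2 := exec_readLine (O := O) (u := lw) (v := revText (n' + 1) rs.reverse)
      (ones := List.replicate N Sym.one) (eol_not_mem_flatMap_encodeInt _)
    have h3 := exec_extendMatrix (O := O) N (n' + 1) lw (Sym.sep :: Sym.sep :: lw ++ [Sym.eol])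
      (List.replicate (lw.count .sep) .sep) rs.reverse (by
        intro r hr
        rw [List.mem_reverse, hrs, List.mem_map] at hr
        obtain ⟨r, -, rfl⟩ := hr
        exact eol_not_mem_flatMap_encodeInt _)
    rw [List.reverse_reverse, ← hP] at h3
    have h4 := exec_moveLeft (O := O) P (List.replicate N .one) lw (Sym.sep :: Sym.sep :: lw ++ [Sym.eol])
      (List.replicate (lw.count .sep) .sep)
    have h5 := exec_makeRows (O := O) l (List.replicate N .one) P.reverse
      (Sym.sep :: Sym.sep :: lw ++ [Sym.eol])
    have hcount : lw.count Sym.sep = n' + 1 := by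
      rw [hlw, count_sep_flatMap_encodeInt, List.length_ofFn]
    rw [← hlw] at h5
    rw [hrev] at h1
    rw [hcount] at h2 h3 h4
    simp only [hrow1] at h5
    have hpush : Exec O (Code.push .inp .sep) (store w' [] [] [] [] [] [] [] [] [])
        (store w [] [] [] [] [] [] [] [] []) 1 0 := by
      refine Exec.push.to rfl ?_ le_rfl le_rfl
      rw [hw'']
      funext k; cases k <;> rfl
    have h6 := hσ.to (τ := store [] [] (List.replicate N .one) (lw ++ [Sym.eol]) [] [] P.reverse
      ((List.finRange (n' + 1)).reverse.flatMap (fun i => Sym.one :: (body i ++ [Sym.eol])) ++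
        (Sym.sep :: Sym.sep :: lw ++ [Sym.eol])) [] []) (by simp) rfl le_rfl le_rfl
    refine (Exec.loop_last (k := .inp) (s := .sep) (w := w') (by rw [hw'']; rfl) rfl
      ((hpush.seq (h1.seq (h2.seq (h3.seq (h4.seq (h5.seq h6)))))).to ?_ rfl le_rfl le_rfl)).mono
      ?_ (by simp)
    · rw [hw'']
      funext k; cases k <;> rfl
    · have h7 : (n' + 1) * (20 * (lw.length + 2) + 1) ≤ N * (20 * (N + 2) + 1) :=
        Nat.mul_le_mul (by omega) (by omega)
      have h8 : rs.length * (10 * N + 6) ≤ N * (10 * N + 6) := Nat.mul_le_mul_right _ (by omega)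
      have h9 : (n' + 1) * (15 * (9 * (N + 1) ^ 2) + 12) ≤ N * (15 * (9 * (N + 1) ^ 2) + 12) :=
        Nat.mul_le_mul_right _ (by omega)
      have h10 : P.length ≤ 9 * (N + 1) ^ 2 := by
        refine le_trans ?_ hB
        simp only [List.length_append]
        omega
      rw [hrevlen]
      simp only [List.length_reverse, List.length_finRange]
      ring_nf at h7 h8 h9 h10 ⊢
      omega
  · rw [hans]
    simp only [hQ, List.mem_reverse, List.mem_finRange, forall_true_left]

theorem exec_reduction_zero {m : ℕ} (A : Matrix (Fin m) (Fin 0) ℤ) (l : Fin 0 → ℤ) :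
    ∃ σ, Exec O reduction (inputStore (encodeMatrix A ++ encodeRow l)) σ 4 0 ∧
      ((σ Stack.ans).head?.isSome ↔ m ≠ 0) := by
  have hrow (r : Fin 0 → ℤ) : encodeRow r = [Sym.eol] := rfl
  have hstore (w : List Sym) : inputStore w = store w [] [] [] [] [] [] [] [] [] := by
    funext k; cases k <;> rfl
  have hpop {f : Option Sym → Code} {s : Sym} {w : List Sym} {σ : Store} {T : ℕ}
      (h : Exec O (f (some s)) (store w [] [] [] [] [] [] [] [] []) σ T 0) :
      Exec O (pop Stack.inp f) (store (s :: w) [] [] [] [] [] [] [] [] []) σ (T + 1) 0 := by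
    refine Exec.loop_last rfl rfl (h.to ?_ rfl le_rfl le_rfl)
    funext k; cases k <;> rfl
  rw [encodeMatrix_eq, hrow, hstore]
  cases m with
  | zero =>
    refine ⟨store [] [] [] [] [] [] [] [] [] [], (hpop (s := Sym.eol) (w := [Sym.eol]) (T := 2)
      ?_).mono (by omega) le_rfl, by simp [store]⟩
    refine Exec.mono (T := 0 + 1 + (0 + 1)) (N := 0 + 0) ?_ le_rfl le_rfl
    exact (hpop (s := Sym.eol) (w := []) Exec.skip).seq (Exec.loop_none rfl rfl Exec.skip)
  | succ m =>
    rw [List.ofFn_succ, List.flatMap_cons, hrow]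
    generalize (List.ofFn fun i : Fin m => A i.succ).flatMap encodeRow = w
    obtain ⟨s, w', hw⟩ : ∃ s w', w ++ [Sym.eol] = s :: w' := by
      cases w with
      | nil => exact ⟨_, _, rfl⟩
      | cons s w => exact ⟨_, _, rfl⟩
    have h : List.replicate 0 Sym.sep ++ Sym.eol :: ([Sym.eol] ++ w) ++ [Sym.eol] =
        Sym.eol :: Sym.eol :: s :: w' := by simp [hw]
    rw [h]
    exact ⟨_, (hpop (s := Sym.eol) (w := Sym.eol :: s :: w') ((hpop Exec.skip).seq
      (hpop Exec.push))).mono (by omega) le_rfl, by simp⟩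

theorem exists_exec_reduction (x : ImplInst) :
    ∃ σ, Exec tropSolv.language reduction (inputStore (tropImpl.encode x)) σ
        (400 * ((tropImpl.encode x).length + 1) ^ 3) x.n ∧
      ((σ Stack.ans).head?.isSome ↔ tropImpl.yes x) := by
  obtain ⟨m, n, A, l⟩ := x
  change ∃ σ, Exec _ _ (inputStore (encodeMatrix A ++ encodeRow l)) σ
    (400 * ((encodeMatrix A ++ encodeRow l).length + 1) ^ 3) n ∧ (_ ↔ Implies A l)
  rcases Nat.eq_zero_or_pos n with rfl | hn
  · obtain ⟨σ, hσ, hans⟩ := exec_reduction_zero (O := tropSolv.language) A l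
    refine ⟨σ, hσ.mono ?_ le_rfl, hans.trans implies_zero_iff.symm⟩
    have := Nat.one_le_pow 3 ((encodeMatrix A ++ encodeRow l).length + 1) (by omega)
    omega
  · have : NeZero n := ⟨hn.ne'⟩
    obtain ⟨σ, hσ, hans⟩ := exec_reduction (O := tropSolv.language) hn.ne'
      (List.ofFn fun i => A i) l (w := encodeMatrix A ++ encodeRow l) (by rw [encodeMatrix_eq])
    refine ⟨σ, hσ, ?_⟩
    have hlen (r : Fin n → ℤ) (k : Fin n) : (encodeInt (r k)).length + 1 ≤ (encodeRow r).length := by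
      rw [encodeRow_eq, List.length_append]
      exact Nat.add_le_add_right (length_le_length_flatMap_of_mem _ (List.mem_ofFn.2 ⟨k, rfl⟩)) 1
    have hM (k : Fin n) : ∀ r ∈ List.ofFn fun i => A i,
        r k - l k < 2 ^ (encodeMatrix A ++ encodeRow l).length - 1 := by
      intro r hr
      refine sub_lt_two_pow_sub_one ((hlen r k).trans ?_) ((hlen l k).trans (by simp))
      have h1 : (encodeRow r).length ≤ ((List.ofFn fun i => A i).flatMap encodeRow).length :=
        length_le_length_flatMap_of_mem _ hr
      rw [encodeMatrix_eq]
      simp only [List.length_append, List.length_cons]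
      omega
    rw [← not_iff_not, not_implies_iff, hans]
    simp only [mem_language_tropSolv_iff, exists_solvesRow_queryRows_iff (hM _)]
    have hsolves (x : Fin n → ℤ) : (∀ r ∈ List.ofFn fun i => A i, SolvesRow r x) ↔ Solves A x := by
      simp only [List.mem_ofFn, forall_exists_index]
      exact ⟨fun h i => h _ i rfl, fun h r i hi => hi ▸ h i⟩
    simp only [hsolves]
    push Not
    rfl

end Trop

theorem mainTheorem11 :
    ∃ M : Trop.OracleMachine,
      M.IsPolyTimeTuringReduction Trop.tropImpl Trop.tropSolv ∧
      ∃ C : ℕ, ∀ (x : Trop.ImplInst) (t : ℕ),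
        M.queryCount Trop.tropSolv.language (Trop.tropImpl.encode x) t ≤ C * (x.n ^ 2 + 1) := by
  refine ⟨Trop.Code.reduction.machine, ⟨400 * (Polynomial.X + 1) ^ 3 + 1, fun x => ?_⟩, 1,
    fun x t => ?_⟩
  · obtain ⟨σ, hσ, hans⟩ := Trop.exists_exec_reduction x
    refine ⟨_, ?_, hans⟩
    have h := hσ.haltsWithin
    simpa using h
  · obtain ⟨σ, hσ, -⟩ := Trop.exists_exec_reduction x
    refine (hσ.queryCount_le t).trans ?_
    have := Nat.le_self_pow (two_ne_zero) x.n
    omega
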